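/- For $n\ge 1$ let $Q_n$ be the $n$-cube, let $v$ be a vertex of $Q_n$, and let $v^{o}$ be the vertex opposite to $v$, that is, the vertex at distance $n$ from $v$. The link of $v$ in the boundary complex of $Q_n$ is the complex of all faces $F$ of $Q_n$ such that $v\notin F$ and $F$ lies in some proper face of $Q_n$ containing $v$. The graph of a complex consists of its vertices and its edges. A graph $G$ is $k$-linked if it has at least $2k$ vertices and, for any $2k$ distinct vertices $s_1,t_1,\dots,s_k,t_k$ of $G$, there are $k$ pairwise vertex-disjoint paths in $G$, the $i$-th of which joins $s_i$ to $t_i$. \begin{proposition} Let $d\ge 0$ be an integer with $d\ne 1$ and $d\neq 3$. For every vertex $v$ of the $(d+1)$-cube $Q_{d+1}$, the link of $v$ in the boundary complex of $Q_{d+1}$ equals the subcomplex $Q_{d+1}-\{v,v^{o}\}$ of all faces of $Q_{d+1}$ that contain neither $v$ nor $v^{o}$, and its graph is $\lfloor (d+1)/2\rfloor$-linked. \end{proposition} -/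

import Mathlib

/-- A graph is `k`-linked if it has at least `2k` vertices and, for any `2k` distinct vertices
organised in `k` pairs `{s i, t i}`, there are pairwise vertex-disjoint paths, the `i`-th of which
joins `s i` to `t i`. -/
def SimpleGraph.IsKLinked {V : Type*} (G : SimpleGraph V) (k : ℕ) : Prop :=
  ((2 * k : ℕ) : ℕ∞) ≤ ENat.card V ∧
    ∀ s t : Fin k → V, Function.Injective (Sum.elim s t) →
      ∃ p : (i : Fin k) → G.Path (s i) (t i),
        ∀ i j : Fin k, i ≠ j →
          ∀ x : V, x ∈ (p i).1.support → x ∉ (p j).1.support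

namespace FaceComplex

/-! A polytopal complex is recorded combinatorially, by the vertex sets of its faces. -/

variable {V : Type*}

/-- The star of the vertex `v`: all faces containing `v`, and the faces of these. -/
def star (C : Set (Set V)) (v : V) : Set (Set V) :=
  {F | F ∈ C ∧ ∃ G ∈ C, v ∈ G ∧ F ⊆ G}

/-- The link of the vertex `v`: all faces of the star of `v` that are disjoint from `v`. -/
def link (C : Set (Set V)) (v : V) : Set (Set V) :=
  {F | F ∈ star C v ∧ v ∉ F}

/-- The complex `C - X` obtained by removing the vertices in `X`: all faces of `C` that contain
only vertices outside `X`. -/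
def deleteVerts (C : Set (Set V)) (X : Set V) : Set (Set V) :=
  {F | F ∈ C ∧ F ⊆ Xᶜ}

/-- The graph of a complex: its vertices are the vertices of `C`, and its edges are the
one-dimensional faces of `C`, that is, the faces with exactly two vertices. -/
def graph (C : Set (Set V)) : SimpleGraph {x : V // {x} ∈ C} where
  Adj x y := x ≠ y ∧ ({x.1, y.1} : Set V) ∈ C
  symm := ⟨fun x y h => ⟨h.1.symm, by rw [Set.pair_comm]; exact h.2⟩⟩
  loopless := ⟨fun _ h => h.1 rfl⟩

end FaceComplex

namespace BoolCube

/-- The complex of all faces of the `n`-cube with vertex set `{0,1}ⁿ`: the empty face, and the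
sets obtained by prescribing the values of some of the coordinates (none of them for the cube
itself). -/
def faces (n : ℕ) : Set (Set (Fin n → Bool)) :=
  {F | F = ∅ ∨ ∃ (I : Set (Fin n)) (a : Fin n → Bool), F = {x | ∀ i ∈ I, x i = a i}}

/-- The boundary complex of the `n`-cube: all its proper faces. -/
def boundary (n : ℕ) : Set (Set (Fin n → Bool)) :=
  {F | F ∈ faces n ∧ F ≠ Set.univ}

/-- The vertex opposite to `v` in the `n`-cube, which differs from `v` in all `n` coordinates. -/
def opposite {n : ℕ} (v : Fin n → Bool) : Fin n → Bool := fun i => !(v i)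

end BoolCube

/-! A face containing `v` and its opposite prescribes no coordinate, so it is the whole cube. A
nonempty face missing the opposite vertex prescribes some coordinate at its value in `v`, so it lies
in a facet through `v`. This identifies the link (`link_boundary`), and it remains to link pairs in
the graph of the cube while avoiding two antipodal vertices.

The general statement is that `k` pairs can be linked in the `n`-cube off a set `Z` if `2 * k + #Z ≤
n + 1`, with `4 ≤ n` once there are two pairs (`linkedAvoiding_of_card_le`). It settles even `d`.
For odd `d` the antipodal set `Z` is one vertex too large, but a facet contains only one of the two,
so a single inductive step leads back to the general statement; `IsSparse` covers both situations.

The inductive step removes one pair and one dimension. A pair and a direction `e` are chosen. The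
chosen pair is joined in the facet of its first end, while all other terminals cross to the opposite
facet and are linked there by induction (`linkedAvoiding_of_landing`). A terminal whose
`e`-neighbour is occupied first moves inside its facet to a neighbour with a free `e`-edge; Hall's
theorem makes these moves distinct (`exists_moves`). The chosen pair then has few enough obstacles
to be joined in its facet, unless one of its ends there is isolated (`joinedIn_of_exists_flipAt`).

Both ways to fail make the counts tight and so force a rigid configuration. If a terminal is
blocked, nearly everything projects to it and its neighbours, and another direction works
(`linkedAvoiding_of_blocked`). Isolation cannot occur for two pairs at once, because the cube is
bipartite (`linkedAvoiding_of_apply_eq`). If all pairs are antipodal, a direction in which the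
second end has a free neighbour excludes both failures (`IsSparse.linkedAvoiding`). -/

/-! ### Joining vertices inside a set. -/

namespace SimpleGraph

variable {V W : Type*} {G : SimpleGraph V} {U U' : Set V} {a b c : V}

/-- Two vertices are joined inside `U` if some walk between them visits only vertices of `U`. -/
def JoinedIn (G : SimpleGraph V) (U : Set V) (a b : V) : Prop :=
  ∃ p : G.Walk a b, ∀ x ∈ p.support, x ∈ U

theorem JoinedIn.refl (ha : a ∈ U) : G.JoinedIn U a a :=
  ⟨Walk.nil, by simpa using ha⟩

theorem JoinedIn.symm (h : G.JoinedIn U a b) : G.JoinedIn U b a := by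
  obtain ⟨p, hp⟩ := h
  exact ⟨p.reverse, by simpa using hp⟩

theorem JoinedIn.trans (h : G.JoinedIn U a b) (h' : G.JoinedIn U b c) : G.JoinedIn U a c := by
  obtain ⟨p, hp⟩ := h
  obtain ⟨q, hq⟩ := h'
  refine ⟨p.append q, fun x hx => ?_⟩
  rcases (Walk.mem_support_append_iff _ _).1 hx with hx | hx
  exacts [hp x hx, hq x hx]

theorem JoinedIn.mono (h : G.JoinedIn U a b) (hU : U ⊆ U') : G.JoinedIn U' a b := by
  obtain ⟨p, hp⟩ := h
  exact ⟨p, fun x hx => hU (hp x hx)⟩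

theorem Adj.joinedIn (h : G.Adj a b) (ha : a ∈ U) (hb : b ∈ U) : G.JoinedIn U a b :=
  ⟨h.toWalk, by simp [ha, hb]⟩

theorem JoinedIn.map {H : SimpleGraph W} (h : G.JoinedIn U a b) (f : G →g H) :
    H.JoinedIn (f '' U) (f a) (f b) := by
  obtain ⟨p, hp⟩ := h
  refine ⟨p.map f, fun x hx => ?_⟩
  rw [Walk.support_map, List.mem_map] at hx
  obtain ⟨y, hy, rfl⟩ := hx
  exact ⟨y, hp y hy, rfl⟩

theorem JoinedIn.right_mem (h : G.JoinedIn U a b) : b ∈ U :=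
  h.choose_spec _ (Walk.end_mem_support _)

/-- The pairs `T (i, false)`, `T (i, true)` can be joined inside pairwise disjoint sets of vertices
that avoid `Z`. -/
def LinkedAvoiding {ι : Type*} (G : SimpleGraph V) (T : ι × Bool → V) (Z : Set V) : Prop :=
  ∃ U : ι → Set V, Pairwise (fun i j => Disjoint (U i) (U j)) ∧
    ∀ i, Disjoint (U i) Z ∧ G.JoinedIn (U i) (T (i, false)) (T (i, true))

end SimpleGraph

/-! ### The graph of the cube: flips, parity, distance, facets. -/

namespace BoolCube

open Finset

variable {n m : ℕ}

/-- The neighbour of `x` in direction `e`. -/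
def flipAt (e : Fin n) (x : Fin n → Bool) : Fin n → Bool := Function.update x e (!x e)

@[simp] theorem flipAt_same (e : Fin n) (x : Fin n → Bool) : flipAt e x e = !x e := by
  simp [flipAt]

theorem flipAt_of_ne {e i : Fin n} (h : i ≠ e) (x : Fin n → Bool) : flipAt e x i = x i := by
  simp [flipAt, h]

@[simp] theorem flipAt_flipAt (e : Fin n) (x : Fin n → Bool) : flipAt e (flipAt e x) = x := by
  simp [flipAt]

theorem flipAt_ne_self (e : Fin n) (x : Fin n → Bool) : flipAt e x ≠ x := fun h => by
  simpa using congrFun h e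

theorem flipAt_left_injective (x : Fin n → Bool) : Function.Injective fun e => flipAt e x := by
  intro e f h
  by_contra hne
  have := congrFun h e
  simp [flipAt_of_ne hne] at this

theorem flipAt_injective (e : Fin n) : Function.Injective (flipAt e) := fun x y h => by
  simpa using congrArg (flipAt e) h

theorem update_flipAt_same (e : Fin n) (b : Bool) (x : Fin n → Bool) :
    Function.update (flipAt e x) e b = Function.update x e b := by
  simp [flipAt]

theorem update_eq_self_of_apply {e : Fin n} {b : Bool} {x : Fin n → Bool} (h : x e = b) :
    Function.update x e b = x := by
  subst h; simp

theorem eq_flipAt_update {e : Fin n} {b : Bool} {x : Fin n → Bool} (h : x e ≠ b) :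
    x = flipAt e (Function.update x e b) := by
  have h' : (!b) = x e := by revert h; cases b <;> cases x e <;> simp
  simp [flipAt, h']

/-- The graph of the `n`-cube. -/
def cube (n : ℕ) : SimpleGraph (Fin n → Bool) where
  Adj x y := ∃ e, y = flipAt e x
  symm := ⟨fun x y ⟨e, h⟩ => ⟨e, by simp [h]⟩⟩
  loopless := ⟨fun x ⟨e, h⟩ => flipAt_ne_self e x h.symm⟩

theorem cube_adj_flipAt (e : Fin n) (x : Fin n → Bool) : (cube n).Adj x (flipAt e x) := ⟨e, rfl⟩

/-- The parity of the number of coordinates equal to `true`. -/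
def parity (x : Fin n → Bool) : ZMod 2 := ∑ i, if x i then 1 else 0

theorem parity_flipAt (e : Fin n) (x : Fin n → Bool) : parity (flipAt e x) = parity x + 1 := by
  unfold parity
  rw [← Finset.add_sum_erase _ _ (mem_univ e), ← Finset.add_sum_erase _ _ (mem_univ e)]
  have : ∀ i ∈ univ.erase e, (if flipAt e x i then (1 : ZMod 2) else 0) = if x i then 1 else 0 :=
    fun i hi => by rw [flipAt_of_ne (ne_of_mem_erase hi)]
  rw [Finset.sum_congr rfl this, flipAt_same]
  cases x e
  · simp [add_comm]
  · simp only [Bool.not_true, if_true]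
    have h2 : (1 : ZMod 2) + 1 = 0 := by decide
    rw [add_right_comm, h2]; simp

/-- The cube is bipartite: one flip changes the parity and two flips preserve it. -/
theorem flipAt_ne_flipAt_flipAt (e f g : Fin n) (x : Fin n → Bool) :
    flipAt e x ≠ flipAt f (flipAt g x) := fun h => by
  have := congrArg parity h
  simp only [parity_flipAt] at this
  revert this
  generalize parity x = y
  revert y
  decide

theorem hammingDist_flipAt_le (e : Fin n) (x : Fin n → Bool) : hammingDist x (flipAt e x) ≤ 1 := by
  unfold hammingDist
  refine (card_le_card (t := {e}) fun i hi => ?_).trans (card_singleton e).le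
  by_contra hne
  exact (mem_filter.1 hi).2 (flipAt_of_ne (by simpa using hne) x).symm

theorem hammingDist_update_le (e : Fin n) (b : Bool) (x : Fin n → Bool) :
    hammingDist x (Function.update x e b) ≤ 1 := by
  by_cases h : x e = b
  · simp [update_eq_self_of_apply h]
  · have := hammingDist_flipAt_le e (Function.update x e b)
    rwa [← eq_flipAt_update h, hammingDist_comm] at this

theorem hammingDist_opposite (x : Fin n → Bool) : hammingDist x (opposite x) = n := by
  simp [hammingDist, opposite]

/-- The inclusion of a facet, as a graph homomorphism. -/
def facetHom (e : Fin (m + 1)) (b : Bool) : cube m →g cube (m + 1) where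
  toFun x := e.insertNth b x
  map_rel' := by
    rintro x _ ⟨f, rfl⟩
    refine ⟨e.succAbove f, ?_⟩
    ext i
    rcases eq_or_ne i e with rfl | hi
    · simp [flipAt_of_ne (Fin.succAbove_ne i f).symm]
    · obtain ⟨j, rfl⟩ := Fin.exists_succAbove_eq hi
      rcases eq_or_ne j f with rfl | hj
      · simp
      · simp [flipAt_of_ne hj, flipAt_of_ne (Fin.succAbove_right_injective.ne hj)]

theorem facetHom_apply_same (e : Fin (m + 1)) (b : Bool) (x : Fin m → Bool) :
    facetHom e b x e = b := by
  simp [facetHom]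

theorem facetHom_injective (e : Fin (m + 1)) (b : Bool) : Function.Injective (facetHom e b) :=
  Fin.insertNth_right_injective (α := fun _ => Bool) b

theorem facetHom_removeNth {e : Fin (m + 1)} {b : Bool} {x : Fin (m + 1) → Bool} (h : x e = b) :
    facetHom e b (e.removeNth x) = x := by
  subst h
  exact Fin.insertNth_self_removeNth e x

theorem facetHom_flipAt (e : Fin (m + 1)) (b : Bool) (f : Fin m) (x : Fin m → Bool) :
    facetHom e b (flipAt f x) = flipAt (e.succAbove f) (facetHom e b x) := by
  ext i
  rcases eq_or_ne i e with rfl | hi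
  · rw [flipAt_of_ne (Fin.succAbove_ne i f).symm, facetHom_apply_same, facetHom_apply_same]
  · obtain ⟨j, rfl⟩ := Fin.exists_succAbove_eq hi
    rcases eq_or_ne j f with rfl | hj
    · simp [facetHom]
    · rw [flipAt_of_ne (Fin.succAbove_right_injective.ne hj)]
      simp [facetHom, flipAt_of_ne hj]

/-- The neighbours of `x` in directions other than `e`. -/
def nbrs (e : Fin n) (x : Fin n → Bool) : Finset (Fin n → Bool) :=
  (univ.erase e).image fun f => flipAt f x

theorem mem_nbrs {e : Fin n} {x y : Fin n → Bool} : y ∈ nbrs e x ↔ ∃ f, f ≠ e ∧ flipAt f x = y := by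
  simp [nbrs]

theorem card_nbrs (e : Fin (m + 1)) (x : Fin (m + 1) → Bool) : #(nbrs e x) = m := by
  rw [nbrs, card_image_of_injective _ (flipAt_left_injective x)]
  simp

theorem nbrs_apply_same {e : Fin n} {x y : Fin n → Bool} (h : y ∈ nbrs e x) : y e = x e := by
  obtain ⟨f, hf, rfl⟩ := mem_nbrs.1 h
  exact flipAt_of_ne hf.symm x

theorem adj_of_mem_nbrs {e : Fin n} {x y : Fin n → Bool} (h : y ∈ nbrs e x) : (cube n).Adj x y := by
  obtain ⟨f, -, rfl⟩ := mem_nbrs.1 h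
  exact cube_adj_flipAt f x

theorem mem_nbrs_comm {e : Fin n} {x y : Fin n → Bool} : y ∈ nbrs e x ↔ x ∈ nbrs e y := by
  simp only [mem_nbrs]
  constructor <;> rintro ⟨f, hf, rfl⟩ <;> exact ⟨f, hf, flipAt_flipAt f _⟩

/-- A common neighbour would form a triangle with the adjacent vertices `x` and `y`, against parity.
-/
theorem disjoint_nbrs {e : Fin n} {x y : Fin n → Bool} (h : y ∈ nbrs e x) :
    Disjoint (nbrs e x) (nbrs e y) := by
  rw [Finset.disjoint_left]
  intro w hw hw'
  obtain ⟨f, -, rfl⟩ := mem_nbrs.1 h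
  obtain ⟨g, -, rfl⟩ := mem_nbrs.1 hw
  obtain ⟨k, -, hk⟩ := mem_nbrs.1 hw'
  exact flipAt_ne_flipAt_flipAt _ _ _ _ hk.symm

theorem hammingDist_le_of_mem_nbrs {e : Fin n} {x y : Fin n → Bool} (h : y ∈ nbrs e x) :
    hammingDist x y ≤ 1 := by
  obtain ⟨f, -, rfl⟩ := mem_nbrs.1 h
  exact hammingDist_flipAt_le f x

/-! ### Connectivity of the cube and of its facets after deleting vertices. -/

/-- A connectedness statement for the `m`-cube holds for the facets of the `m + 1`-cube. -/
theorem joinedIn_facet (e : Fin (m + 1)) (b : Bool) (S : Finset (Fin (m + 1) → Bool))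
    {x y : Fin (m + 1) → Bool} (hx : x e = b) (hy : y e = b)
    (H : ∀ S' : Finset (Fin m → Bool), #S' ≤ #(S.filter (· e = b)) →
      (∀ w, w ∈ S' ↔ facetHom e b w ∈ S) →
      (cube m).JoinedIn {w | w ∉ S'} (e.removeNth x) (e.removeNth y)) :
    (cube (m + 1)).JoinedIn {w | w e = b ∧ w ∉ S} x y := by
  have h := H (univ.filter fun w => facetHom e b w ∈ S)
    (card_le_card_of_injOn (facetHom e b) (fun w hw => by
      have := (mem_filter.1 hw).2
      simpa [facetHom_apply_same] using this) (facetHom_injective e b).injOn) (by simp)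
  have h' := h.map (facetHom e b)
  rw [facetHom_removeNth hx, facetHom_removeNth hy] at h'
  refine h'.mono ?_
  rintro _ ⟨w, hw, rfl⟩
  exact ⟨facetHom_apply_same e b w, by simpa using hw⟩

/-- The `m`-cube is `m`-connected. -/
theorem joinedIn_of_card_le (S : Finset (Fin m → Bool)) (hS : #S ≤ m - 1) {x y : Fin m → Bool}
    (hx : x ∉ S) (hy : y ∉ S) : (cube m).JoinedIn {w | w ∉ S} x y := by
  induction m with
  | zero => rw [Subsingleton.elim y x]; exact .refl hx
  | succ m ih =>
    rcases eq_or_ne x y with rfl | hxy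
    · exact .refl hx
    obtain ⟨e, he⟩ := Function.ne_iff.1 hxy
    have side : ∀ {b : Bool} {u w : Fin (m + 1) → Bool}, #(S.filter (· e = b)) ≤ m - 1 →
        u e = b → w e = b → u ∉ S → w ∉ S → (cube (m + 1)).JoinedIn {w | w ∉ S} u w := by
      intro b u w hc hu hw huS hwS
      refine (joinedIn_facet e b S hu hw fun S' hS' hmem => ih S' (hS'.trans hc) ?_ ?_).mono
        fun _ h => h.2
      · rwa [hmem, facetHom_removeNth hu]
      · rwa [hmem, facetHom_removeNth hw]
    have key : ∀ {x y : Fin (m + 1) → Bool}, x ∉ S → y ∉ S → x e ≠ y e →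
        S.filter (· e = y e) = ∅ → (cube (m + 1)).JoinedIn {w | w ∉ S} x y := by
      intro x y hx hy he h0
      have hf : flipAt e x e = y e := by
        rw [flipAt_same]; revert he; cases x e <;> cases y e <;> simp
      have hfS : flipAt e x ∉ S := fun h => by
        have : flipAt e x ∈ S.filter (· e = y e) := mem_filter.2 ⟨h, hf⟩
        simp [h0] at this
      exact ((cube_adj_flipAt e x).joinedIn hx hfS).trans (side (by simp [h0]) hf rfl hfS hy)
    by_cases h0 : S.filter (· e = y e) = ∅
    · exact key hx hy he h0
    by_cases h1 : S.filter (· e = x e) = ∅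
    · exact (key hy hx he.symm h1).symm
    have hsum : #(S.filter (· e = x e)) + #(S.filter (· e = y e)) ≤ #S := by
      rw [← card_union_of_disjoint]
      · exact card_le_card (union_subset (filter_subset _ _) (filter_subset _ _))
      · refine disjoint_filter.2 fun w _ h h' => he (h.symm.trans h')
    have p0 := card_pos.2 (nonempty_iff_ne_empty.2 h0)
    have p1 := card_pos.2 (nonempty_iff_ne_empty.2 h1)
    -- Both sides now contain deleted vertices, so each contains at most `m - 1` of them. As `#S ≤ m
    -- < 2 ^ m`, some edge in direction `e` has both ends outside `S`, and the path crosses there.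
    obtain ⟨w, hw⟩ : ∃ w, w ∉ S.image (fun v => e.removeNth v) := by
      by_contra! hall
      have h2 : #(univ : Finset (Fin m → Bool)) ≤ #S :=
        (card_le_card fun w _ => hall w).trans card_image_le
      rw [card_univ, Fintype.card_fun, Fintype.card_bool, Fintype.card_fin] at h2
      have := Nat.lt_two_pow_self (n := m)
      omega
    have hwS : ∀ b, facetHom e b w ∉ S := fun b hb =>
      hw (mem_image.2 ⟨_, hb, by simp [facetHom]⟩)
    have hadj : facetHom e (y e) w = flipAt e (facetHom e (x e) w) := by
      have h3 : facetHom e (y e) w e ≠ x e := by rw [facetHom_apply_same]; exact he.symm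
      rw [eq_flipAt_update h3]
      simp [facetHom]
    refine (side (by omega) rfl (facetHom_apply_same e _ w) hx (hwS _)).trans
      (.trans ?_ (side (by omega) (facetHom_apply_same e _ w) rfl (hwS _) hy))
    exact SimpleGraph.Adj.joinedIn (hadj ▸ cube_adj_flipAt _ _) (hwS _) (hwS _)

/-- Deleting at most `2m - 3` vertices from the `m`-cube leaves all vertices that are not isolated
in one component. -/
theorem joinedIn_of_exists_flipAt (S : Finset (Fin m → Bool)) (hS : #S + 3 ≤ 2 * m)
    {x y : Fin m → Bool} (hx : x ∉ S) (hy : y ∉ S) (hx' : ∃ f, flipAt f x ∉ S)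
    (hy' : ∃ f, flipAt f y ∉ S) : (cube m).JoinedIn {w | w ∉ S} x y := by
  obtain _ | m := m
  · omega
  let e : Fin (m + 1) := 0
  -- Here `#S ≤ 2 * m - 1`, so one of the two facets loses at most `m - 1` vertices and stays
  -- connected. It remains to reach it from `x` and from `y`.
  obtain ⟨b, hb⟩ : ∃ b, #(S.filter (· e = b)) ≤ m - 1 := by
    have : #(S.filter (· e = true)) + #(S.filter (· e = false)) = #S := by
      rw [← card_filter_add_card_filter_not (s := S) (· e = true)]
      simp
    rcases le_total #(S.filter (· e = true)) #(S.filter (· e = false)) with h | h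
    · exact ⟨true, by omega⟩
    · exact ⟨false, by omega⟩
  have escape : ∀ x, x ∉ S → (∃ f, flipAt f x ∉ S) →
      ∃ u, u e = b ∧ u ∉ S ∧ (cube (m + 1)).JoinedIn {w | w ∉ S} x u := by
    rintro x hx ⟨f, hf⟩
    by_cases hxe : x e = b
    · exact ⟨x, hxe, hx, .refl hx⟩
    have hflip : ∀ v : Fin (m + 1) → Bool, v e = x e → flipAt e v e = b := by
      intro v hv
      rw [flipAt_same, hv]; revert hxe; cases x e <;> cases b <;> simp
    have h1 := (cube_adj_flipAt f x).joinedIn (U := {w | w ∉ S}) hx hf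
    by_cases hfe : f = e
    · subst hfe
      exact ⟨_, hflip x rfl, hf, h1⟩
    have hfn : flipAt f x ∈ nbrs e x := mem_nbrs.2 ⟨f, hfe, rfl⟩
    -- Inside their facet, `x` and `flipAt f x` have `2 * m` neighbours in total, all distinct. If
    -- each had a deleted end on its edge in direction `e`, these disjoint edges would need `2 * m`
    -- vertices of `S`.
    obtain ⟨v, hv, hvS, hvS'⟩ :
        ∃ v ∈ nbrs e x ∪ nbrs e (flipAt f x), v ∉ S ∧ flipAt e v ∉ S := by
      by_contra! hall
      have hcard : #(nbrs e x ∪ nbrs e (flipAt f x)) ≤ #S := by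
        refine card_le_card_of_injOn (fun v => if v ∈ S then v else flipAt e v) ?_ ?_
        · intro v hv
          by_cases hvS : v ∈ S
          · simp [hvS]
          · simpa [hvS] using hall v hv hvS
        · have hside : ∀ v ∈ nbrs e x ∪ nbrs e (flipAt f x), v e = x e := by
            intro v hv
            rcases mem_union.1 hv with hv | hv
            · exact nbrs_apply_same hv
            · rw [nbrs_apply_same hv, nbrs_apply_same hfn]
          have hup : ∀ v ∈ nbrs e x ∪ nbrs e (flipAt f x),
              Function.update (if v ∈ S then v else flipAt e v) e (x e) = v := by
            intro v hv
            split_ifs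
            · exact update_eq_self_of_apply (hside v hv)
            · rw [update_flipAt_same, update_eq_self_of_apply (hside v hv)]
          intro v hv w hw h
          rw [← hup v hv, ← hup w hw]
          exact congrArg (fun u => Function.update u e (x e)) h
      rw [card_union_of_disjoint (disjoint_nbrs hfn), card_nbrs, card_nbrs] at hcard
      omega
    have hjoin : (cube (m + 1)).JoinedIn {w | w ∉ S} x v := by
      rcases mem_union.1 hv with hv | hv
      · exact (adj_of_mem_nbrs hv).joinedIn hx hvS
      · exact h1.trans ((adj_of_mem_nbrs hv).joinedIn hf hvS)
    refine ⟨flipAt e v, hflip v ?_, hvS', hjoin.trans ((cube_adj_flipAt e v).joinedIn hvS hvS')⟩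
    rcases mem_union.1 hv with hv | hv
    · exact nbrs_apply_same hv
    · rw [nbrs_apply_same hv, nbrs_apply_same hfn]
  obtain ⟨u, hu, huS, hxu⟩ := escape x hx hx'
  obtain ⟨w, hw, hwS, hyw⟩ := escape y hy hy'
  refine hxu.trans (.trans ?_ hyw.symm)
  refine (joinedIn_facet e b S hu hw fun S' hS' hmem =>
    joinedIn_of_card_le S' (hS'.trans hb) ?_ ?_).mono fun _ h => h.2
  · rwa [hmem, facetHom_removeNth hu]
  · rwa [hmem, facetHom_removeNth hw]

/-- The version of `joinedIn_of_exists_flipAt` for a facet of the `m + 1`-cube. -/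
theorem joinedIn_facet_of_not_subset (e : Fin (m + 1)) (S : Finset (Fin (m + 1) → Bool))
    (hS : #S + 3 ≤ 2 * m) {x y : Fin (m + 1) → Bool} (hxy : y e = x e) (hx : x ∉ S) (hy : y ∉ S)
    (hx' : ¬ nbrs e x ⊆ S) (hy' : ¬ nbrs e y ⊆ S) :
    (cube (m + 1)).JoinedIn {w | w e = x e ∧ w ∉ S} x y := by
  have hfree : ∀ u : Fin (m + 1) → Bool, u e = x e → ¬ nbrs e u ⊆ S →
      ∃ f, facetHom e (x e) (flipAt f (e.removeNth u)) ∉ S := by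
    intro u hu h
    obtain ⟨w, hw, hwS⟩ := Finset.not_subset.1 h
    obtain ⟨g, hg, rfl⟩ := mem_nbrs.1 hw
    obtain ⟨f, rfl⟩ := Fin.exists_succAbove_eq hg
    exact ⟨f, by rwa [facetHom_flipAt, facetHom_removeNth hu]⟩
  refine joinedIn_facet e (x e) S rfl hxy fun S' hS' hmem =>
    joinedIn_of_exists_flipAt S' ?_ ?_ ?_ ?_ ?_
  · have := card_filter_le S (· e = x e)
    omega
  · rwa [hmem, facetHom_removeNth rfl]
  · rwa [hmem, facetHom_removeNth hxy]
  · simpa only [hmem] using hfree x rfl hx'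
  · simpa only [hmem] using hfree y hxy hy'

end BoolCube

/-! ### Distinct representatives. -/

/-- Hall's condition for a proper subset of `C` follows from `h₁` at any one of its elements. Only
`C` itself needs more: two elements by `h₂`, or `h₃` if `C` is a singleton. -/
theorem Finset.exists_injOn_of_card_le_union {α β : Type*} [DecidableEq β] [Nonempty β] (C : Finset α)
    (F : α → Finset β) (h₁ : ∀ a ∈ C, C.card ≤ (F a).card + 1)
    (h₂ : ∀ a ∈ C, ∀ b ∈ C, a ≠ b → C.card ≤ (F a ∪ F b).card)
    (h₃ : ∀ a, C = {a} → (F a).Nonempty) :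
    ∃ f : α → β, (∀ a ∈ C, f a ∈ F a) ∧ Set.InjOn f C := by
  classical
  obtain ⟨f, hf, hfF⟩ := (Finset.all_card_le_biUnion_card_iff_exists_injective
    (fun a : C => F a)).1 fun A => by
      rcases A.eq_empty_or_nonempty with rfl | ⟨a, ha⟩
      · simp
      have hsub : ∀ b ∈ A, F b ⊆ A.biUnion fun a => F a := fun b hb =>
        Finset.subset_biUnion_of_mem (fun a : C => F a) hb
      have hAC : A.card ≤ C.card := by simpa using Finset.card_le_univ A
      by_cases hlt : A.card < C.card
      · have := h₁ a a.2
        have := Finset.card_le_card (hsub a ha)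
        omega
      have hAu : A = Finset.univ := by
        rw [← Finset.card_eq_iff_eq_univ, Fintype.card_coe]; omega
      by_cases hb : ∃ b ∈ C, b ≠ a
      · obtain ⟨b, hb, hba⟩ := hb
        refine hAC.trans ((h₂ a a.2 b hb hba.symm).trans (Finset.card_le_card ?_))
        exact Finset.union_subset (hsub a ha) (hsub ⟨b, hb⟩ (by simp [hAu]))
      · push Not at hb
        have hC : C = {a.1} := Finset.eq_singleton_iff_unique_mem.2 ⟨a.2, hb⟩
        have h1 := (h₃ a hC).card_pos
        have h2 : C.card = 1 := by rw [hC]; simp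
        have := Finset.card_le_card (hsub a ha)
        omega
  rcases C.eq_empty_or_nonempty with rfl | ⟨a₀, ha₀⟩
  · exact ⟨fun _ => Classical.arbitrary β, by simp, by simp⟩
  refine ⟨fun a => if h : a ∈ C then f ⟨a, h⟩ else f ⟨a₀, ha₀⟩, fun a ha => ?_, ?_⟩
  · simpa [ha] using hfF ⟨a, ha⟩
  · intro a ha b hb hab
    rw [Finset.mem_coe] at ha hb
    have h : f ⟨a, ha⟩ = f ⟨b, hb⟩ := by simpa [ha, hb] using hab
    exact congrArg Subtype.val (hf h)

/-! ### Assembling a linkage from two opposite facets. -/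

namespace BoolCube

open Finset

variable {m : ℕ} {ι : Type*}

/-- A linkage statement for the `m`-cube holds for the facets of the `m + 1`-cube. -/
theorem linkedAvoiding_facet (e : Fin (m + 1)) (b : Bool) (W : Finset (Fin (m + 1) → Bool))
    {T : ι × Bool → Fin (m + 1) → Bool} (hside : ∀ p, T p e = b) (hT : Function.Injective T)
    (hTW : ∀ p, T p ∉ W)
    (H : ∀ (W' : Finset (Fin m → Bool)) (T' : ι × Bool → Fin m → Bool), Function.Injective T' →
      (∀ p, T' p ∉ W') → #W' ≤ #(W.filter (· e = b)) → (cube m).LinkedAvoiding T' W') :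
    (cube (m + 1)).LinkedAvoiding T {w | w ∈ W ∨ w e ≠ b} := by
  have hT' : ∀ p, facetHom e b (e.removeNth (T p)) = T p := fun p => facetHom_removeNth (hside p)
  obtain ⟨U, hU, hUW⟩ := H (univ.filter fun w => facetHom e b w ∈ W)
    (fun p => e.removeNth (T p))
    (fun p q hpq => hT (by rw [← hT' p, ← hT' q]; exact congrArg _ hpq))
    (fun p => by simp [hT', hTW])
    (card_le_card_of_injOn (facetHom e b) (fun w hw => by
      have := (mem_filter.1 hw).2
      simpa [facetHom_apply_same] using this) (facetHom_injective e b).injOn)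
  refine ⟨fun i => facetHom e b '' U i, fun i j hij => ?_, fun i => ⟨?_, ?_⟩⟩
  · exact Set.disjoint_image_of_injective (facetHom_injective e b) (hU hij)
  · rw [Set.disjoint_left]
    rintro _ ⟨w, hw, rfl⟩ (h | h)
    · exact Set.disjoint_left.1 (hUW i).1 hw (by simpa using h)
    · exact h (facetHom_apply_same e b w)
  · simpa only [hT'] using (hUW i).2.map (facetHom e b)

/-- If all terminals except those of one pair can be moved disjointly to the facet opposite to
`T (i₀, false)` in direction `e`, where they can be linked, and the remaining pair can be joined in
the facet of `T (i₀, false)`, then all pairs can be linked. -/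
theorem linkedAvoiding_of_landing {T : ι × Bool → Fin (m + 1) → Bool}
    {Z S : Finset (Fin (m + 1) → Bool)} (hT : Function.Injective T) (hTZ : ∀ p, T p ∉ Z)
    {e : Fin (m + 1)} {i₀ : ι} {b : Bool} (y : ι × Bool → Fin (m + 1) → Bool)
    (hyb : ∀ p, p.1 ≠ i₀ → y p e = b)
    (hyinj : ∀ p q, p.1 ≠ i₀ → q.1 ≠ i₀ → y p = y q → p = q)
    (hy₁ : ∀ p, p.1 ≠ i₀ → T p e ≠ b → y p = Function.update (T p) e b)
    (hy₀ : ∀ p, p.1 ≠ i₀ → T p e = b → T p = y p ∨ (cube (m + 1)).Adj (T p) (y p))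
    (hyZ : ∀ p, p.1 ≠ i₀ → T p e = b → y p ∉ Z)
    (hyT : ∀ p, p.1 ≠ i₀ → T p e = b → ∀ q, q.1 ≠ i₀ → T q e = b → y p = T q → p = q)
    (hZS : ∀ z ∈ Z, z e = b → z ∈ S)
    (hyS : ∀ p, p.1 ≠ i₀ → T p e = b → T p ∈ S ∧ y p ∈ S)
    (hpath : (cube (m + 1)).JoinedIn {w | w e = b ∧ w ∉ S} (T (i₀, false))
      (Function.update (T (i₀, true)) e b))
    (hlink : (cube (m + 1)).LinkedAvoiding
      (fun p : {i // i ≠ i₀} × Bool => flipAt e (y (p.1, p.2)))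
      {w | w ∈ insert (T (i₀, true)) Z ∨ w e ≠ !b}) :
    (cube (m + 1)).LinkedAvoiding T Z := by
  obtain ⟨V, hV, hVZ⟩ := hlink
  set t := T (i₀, true) with htdef
  have hVmem : ∀ i w, w ∈ V i → w ∉ Z ∧ w ≠ t ∧ w e ≠ b := fun i w hw => by
    have := Set.disjoint_left.1 (hVZ i).1 hw
    simp only [Set.mem_ofPred_eq, mem_insert, not_or, not_not] at this
    exact ⟨this.1.2, this.1.1, by rw [this.2]; cases b <;> simp⟩
  let A : ι × Bool → Set (Fin (m + 1) → Bool) := fun p => {w | T p e = b ∧ (w = T p ∨ w = y p)}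
  have htS : t e = b → t ∉ S := fun h => by
    have := hpath.right_mem.2
    rwa [update_eq_self_of_apply h] at this
  have hA : ∀ p, p.1 ≠ i₀ → ∀ w ∈ A p, w e = b ∧ w ∈ S ∧ w ∉ Z := by
    rintro p hp w ⟨hpb, rfl | rfl⟩
    · exact ⟨hpb, (hyS p hp hpb).1, hTZ p⟩
    · exact ⟨hyb p hp, (hyS p hp hpb).2, hyZ p hp hpb⟩
  have hAA : ∀ p q, p.1 ≠ i₀ → q.1 ≠ i₀ → ∀ w, w ∈ A p → w ∈ A q → p = q := by
    rintro p q hp hq w ⟨hpb, hw⟩ ⟨hqb, hw'⟩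
    rcases hw with rfl | rfl <;> rcases hw' with h | h
    · exact hT h
    · exact (hyT q hq hqb p hp hpb h.symm).symm
    · exact hyT p hp hpb q hq hqb h
    · exact hyinj p q hp hq h
  -- The pair `i₀` receives the facet off `S`, together with its end `t`. Any other pair receives
  -- its set in the opposite facet, together with the initial and landing positions of its ends that
  -- start on the side `b`.
  refine ⟨fun i => {w | (i = i₀ ∧ (w = t ∨ w e = b ∧ w ∉ S)) ∨
    ∃ h : i ≠ i₀, w ∈ V ⟨i, h⟩ ∨ ∃ c, w ∈ A (i, c)}, ?_, fun i => ⟨?_, ?_⟩⟩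
  · have key : ∀ i, i ≠ i₀ → ∀ w, (w = t ∨ w e = b ∧ w ∉ S) →
        ¬ ∃ h : i ≠ i₀, w ∈ V ⟨i, h⟩ ∨ ∃ c, w ∈ A (i, c) := by
      rintro i hi w hw ⟨h, hw' | ⟨c, hw'⟩⟩
      · obtain ⟨-, h2, h3⟩ := hVmem _ _ hw'
        rcases hw with rfl | hw
        exacts [h2 rfl, h3 hw.1]
      · obtain ⟨h1, h2, h3⟩ := hA (i, c) hi w hw'
        rcases hw with rfl | hw
        exacts [htS h1 h2, hw.2 h2]
    intro i j hij
    rw [Set.disjoint_left]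
    rintro w (⟨rfl, hw⟩ | ⟨hi, hw⟩) (⟨rfl, hw'⟩ | ⟨hj, hw'⟩)
    · exact hij rfl
    · exact key j hj w hw ⟨hj, hw'⟩
    · exact key i hi w hw' ⟨hi, hw⟩
    · rcases hw with hw | ⟨c, hw⟩ <;> rcases hw' with hw' | ⟨c', hw'⟩
      · exact Set.disjoint_left.1 (hV (i := ⟨i, hi⟩) (j := ⟨j, hj⟩) (by simpa using hij)) hw hw'
      · exact (hVmem _ _ hw).2.2 (hA (j, c') hj w hw').1
      · exact (hVmem _ _ hw').2.2 (hA (i, c) hi w hw).1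
      · exact hij (congrArg Prod.fst (hAA (i, c) (j, c') hi hj w hw hw'))
  · rw [Set.disjoint_left]
    rintro w (⟨rfl, rfl | hw⟩ | ⟨hi, hw | ⟨c, hw⟩⟩) hwZ
    · exact hTZ _ hwZ
    · exact hw.2 (hZS w hwZ hw.1)
    · exact (hVmem _ _ hw).1 hwZ
    · exact (hA (i, c) hi w hw).2.2 hwZ
  · by_cases hi : i = i₀
    · subst hi
      refine (hpath.mono fun w hw => Or.inl ⟨rfl, Or.inr hw⟩).trans ?_
      by_cases htb : t e = b
      · rw [update_eq_self_of_apply htb]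
        exact .refl (Or.inl ⟨rfl, Or.inl rfl⟩)
      · have h := cube_adj_flipAt e (Function.update t e b)
        rw [← eq_flipAt_update htb] at h
        exact h.joinedIn (Or.inl ⟨rfl, Or.inr hpath.right_mem⟩) (Or.inl ⟨rfl, Or.inl rfl⟩)
    · have hj := (hVZ ⟨i, hi⟩).2
      have hup : ∀ c, flipAt e (y (i, c)) ∈ V ⟨i, hi⟩ := by
        rintro (_ | _)
        exacts [hj.symm.right_mem, hj.right_mem]
      have hmove : ∀ c, (cube (m + 1)).JoinedIn {w | (i = i₀ ∧ (w = t ∨ w e = b ∧ w ∉ S)) ∨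
          ∃ h : i ≠ i₀, w ∈ V ⟨i, h⟩ ∨ ∃ c, w ∈ A (i, c)} (T (i, c)) (flipAt e (y (i, c))) := by
        intro c
        by_cases hb : T (i, c) e = b
        · have hy : y (i, c) ∈ {w | (i = i₀ ∧ (w = t ∨ w e = b ∧ w ∉ S)) ∨
              ∃ h : i ≠ i₀, w ∈ V ⟨i, h⟩ ∨ ∃ c, w ∈ A (i, c)} :=
            Or.inr ⟨hi, Or.inr ⟨c, hb, Or.inr rfl⟩⟩
          have h2 := (cube_adj_flipAt e (y (i, c))).joinedIn hy (Or.inr ⟨hi, Or.inl (hup c)⟩)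
          rcases hy₀ (i, c) hi hb with h | h
          · rwa [← h] at h2 ⊢
          · exact (h.joinedIn (Or.inr ⟨hi, Or.inr ⟨c, hb, Or.inl rfl⟩⟩) hy).trans h2
        · have h : flipAt e (y (i, c)) = T (i, c) := by
            rw [hy₁ (i, c) hi hb]; exact (eq_flipAt_update hb).symm
          have h' := hup c
          rw [h] at h' ⊢
          exact .refl (Or.inr ⟨hi, Or.inl h'⟩)
      exact (hmove false).trans ((hj.mono fun w hw => Or.inr ⟨hi, Or.inl hw⟩).trans
        (hmove true).symm)

end BoolCube

/-! ### Sparse configurations: counting terminals, shadows and conflicts. -/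

namespace BoolCube

open Finset

variable {m : ℕ} {ι : Type*}

theorem opposite_opposite (x : Fin m → Bool) : opposite (opposite x) = x := by
  ext i; simp [opposite]

theorem hammingDist_le_of_adj_flipAt {x y z : Fin m → Bool} {e : Fin m} (h : flipAt e x = z) :
    hammingDist y z ≤ hammingDist y x + 1 := by
  subst h
  exact (hammingDist_triangle y x _).trans (by have := hammingDist_flipAt_le e x; omega)

section

variable [Fintype ι] {T : ι × Bool → Fin (m + 1) → Bool} {Z : Finset (Fin (m + 1) → Bool)}
  {e : Fin (m + 1)}

/-- The terminals together with the forbidden vertices. -/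
def points (T : ι × Bool → Fin (m + 1) → Bool) (Z : Finset (Fin (m + 1) → Bool)) :
    Finset (Fin (m + 1) → Bool) := univ.image T ∪ Z

/-- Distinct terminals in the cube of dimension `m + 1 ≥ 4`, off the forbidden set `Z`. There are at
most `m + 2` terminals and forbidden vertices, or `m + 3` if the forbidden vertices are antipodal
and the dimension is at least six. -/
structure IsSparse (T : ι × Bool → Fin (m + 1) → Bool) (Z : Finset (Fin (m + 1) → Bool)) :
    Prop where
  injective : Function.Injective T
  notMem : ∀ p, T p ∉ Z
  three_le : 3 ≤ m
  card : 2 * Fintype.card ι + #Z ≤ m + 2 ∨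
    (2 * Fintype.card ι ≤ m + 1 ∧ 5 ≤ m ∧ ∃ z, Z = {z, opposite z})

theorem mem_points_left (p : ι × Bool) : T p ∈ points T Z :=
  mem_union_left _ (mem_image_of_mem _ (mem_univ p))

theorem mem_points_right {z : Fin (m + 1) → Bool} (hz : z ∈ Z) : z ∈ points T Z :=
  mem_union_right _ hz

theorem mem_points {w : Fin (m + 1) → Bool} : w ∈ points T Z ↔ (∃ p, T p = w) ∨ w ∈ Z := by
  simp [points]

theorem card_points_le : #(points T Z) ≤ 2 * Fintype.card ι + #Z := by
  refine (card_union_le _ _).trans (Nat.add_le_add_right (card_image_le.trans ?_) _)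
  simp [mul_comm]

/-- The projection of all terminals and forbidden vertices to the facet `{x | x e = b}`. -/
def shadow (T : ι × Bool → Fin (m + 1) → Bool) (Z : Finset (Fin (m + 1) → Bool))
    (e : Fin (m + 1)) (b : Bool) : Finset (Fin (m + 1) → Bool) :=
  (points T Z).image fun w => Function.update w e b

theorem update_mem_shadow {w : Fin (m + 1) → Bool} (hw : w ∈ points T Z) (b : Bool) :
    Function.update w e b ∈ shadow T Z e b := mem_image_of_mem _ hw

theorem mem_shadow_of_apply {w : Fin (m + 1) → Bool} {b : Bool} (hw : w ∈ points T Z)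
    (hb : w e = b) : w ∈ shadow T Z e b := by
  simpa only [update_eq_self_of_apply hb] using update_mem_shadow (e := e) hw b

/-- Antipodal vertices lie in opposite facets, so the excess vertex of the second case disappears on
restriction to a facet. -/
theorem IsSparse.card_filter_le (h : IsSparse T Z) (e : Fin (m + 1)) (b : Bool) :
    2 * Fintype.card ι + #(Z.filter (· e = b)) ≤ m + 2 := by
  rcases h.card with h | ⟨h, -, z, rfl⟩
  · exact (Nat.add_le_add_left (Finset.card_filter_le _ _) _).trans h
  · have : #(({z, opposite z} : Finset (Fin (m + 1) → Bool)).filter (· e = b)) ≤ 1 := by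
      rw [card_le_one]
      intro x hx y hy
      simp only [mem_filter, mem_insert, mem_singleton] at hx hy
      obtain ⟨rfl | rfl, hx⟩ := hx <;> obtain ⟨rfl | rfl, hy⟩ := hy
      · rfl
      · subst hx; simp [opposite] at hy
      · subst hy; simp [opposite] at hx
      · rfl
    omega

/-- When `Z` is antipodal the total exceeds `m + 2` by one. The set `E` holds one forbidden vertex
that pays for the excess: its projection is neither of the two terminals and blocks no neighbour of
at least one of them. -/
theorem IsSparse.exists_far (h : IsSparse T Z) (e : Fin (m + 1)) (p q : ι × Bool) :
    ∃ E ⊆ Z, #E ≤ 1 ∧ 2 * Fintype.card ι + #Z ≤ m + 2 + #E ∧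
      (∀ z ∈ E, Function.update z e (T p e) ≠ T p ∧ Function.update z e (T p e) ≠ T q) ∧
      ((∀ z ∈ E, Function.update z e (T p e) ∉ nbrs e (T p)) ∨
        (∀ z ∈ E, Function.update z e (T p e) ∉ nbrs e (T q))) ∧
      ∀ z ∈ E, 5 ≤ m ∧ opposite z ∈ Z \ E := by
  rcases h.card with hc | ⟨hc, hm, z₀, hz₀⟩
  · exact ⟨∅, by simp, by simp, by simpa using hc, by simp, by simp, by simp⟩
  obtain ⟨z, hzb, hz⟩ : ∃ z, z e = T p e ∧ Z = {z, opposite z} := by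
    by_cases hb : z₀ e = T p e
    · exact ⟨z₀, hb, hz₀⟩
    · refine ⟨opposite z₀, ?_, by rw [opposite_opposite, pair_comm, hz₀]⟩
      revert hb
      simp only [opposite]
      cases z₀ e <;> cases T p e <;> simp
  have hzZ : z ∈ Z := by simp [hz]
  have hzZ' : opposite z ∈ Z := by simp [hz]
  have hne : z ≠ opposite z := fun h' => by
    have := hammingDist_opposite z
    rw [← h', hammingDist_self] at this
    omega
  have hcard : #Z = 2 := by rw [hz, card_pair hne]
  have hzp : z ≠ T p := fun h' => h.notMem p (h' ▸ hzZ)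
  have hzq : z ≠ T q := fun h' => h.notMem q (h' ▸ hzZ)
  have hup : Function.update z e (T p e) = z := update_eq_self_of_apply hzb
  have hmem : opposite z ∈ Z \ {z} := by simp [hzZ', hne.symm]
  by_cases h1 : z ∈ nbrs e (T p)
  · by_cases h2 : z ∈ nbrs e (T q)
    -- Now `z` is adjacent to both terminals, so the projection of its opposite has distance at
    -- least `m - 1 ≥ 4` from each.
    · set z' := Function.update (opposite z) e (T p e) with hz'
      have hd : ∀ x, z ∈ nbrs e x → z' ≠ x ∧ z' ∉ nbrs e x := by
        intro x hx
        have d1 := hammingDist_le_of_mem_nbrs hx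
        have d2 := hammingDist_triangle z x (opposite z)
        have d3 := hammingDist_triangle x z' (opposite z)
        have d4 : hammingDist z' (opposite z) ≤ 1 := by
          rw [hammingDist_comm]; exact hammingDist_update_le e (T p e) (opposite z)
        rw [hammingDist_opposite] at d2
        rw [hammingDist_comm] at d1
        refine ⟨fun h' => ?_, fun h' => ?_⟩
        · rw [← h', hammingDist_self] at d3
          rw [← h'] at d2 d1
          omega
        · have := hammingDist_le_of_mem_nbrs h'
          omega
      refine ⟨{opposite z}, by simpa using hzZ', by simp, by simp; omega, ?_, Or.inl ?_, ?_⟩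
      · simpa using ⟨(hd _ h1).1, (hd _ h2).1⟩
      · simpa using (hd _ h1).2
      · simp [opposite_opposite, hzZ, hne, hm]
    · refine ⟨{z}, by simpa using hzZ, by simp, by simp; omega, ?_, Or.inr ?_, ?_⟩
      · simpa [hup] using ⟨hzp, hzq⟩
      · simpa [hup] using h2
      · simpa [hm] using ⟨hzZ', hne.symm⟩
  · refine ⟨{z}, by simpa using hzZ, by simp, by simp; omega, ?_, Or.inl ?_, ?_⟩
    · simpa [hup] using ⟨hzp, hzq⟩
    · simpa [hup] using h1
    · simpa [hm] using ⟨hzZ', hne.symm⟩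

/-- If a pair is antipodal, one of its ends has a neighbour that is neither a terminal nor
forbidden. -/
theorem IsSparse.exists_flipAt_notMem (h : IsSparse T Z) {i₀ : ι}
    (hi : ∀ e, T (i₀, true) e ≠ T (i₀, false) e) :
    ∃ e, flipAt e (T (i₀, true)) ∉ points T Z := by
  by_contra! hall
  set s := T (i₀, false)
  set t := T (i₀, true)
  have hm := h.three_le
  have hst : hammingDist t s = m + 1 := by
    simp [hammingDist, hi]
  have hd : ∀ e, hammingDist t (flipAt e t) ≤ 1 := fun e => hammingDist_flipAt_le e t
  have hsub : ∀ R : Finset (Fin (m + 1) → Bool), (∀ r ∈ R, ∀ e, flipAt e t ≠ r) →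
      R ⊆ points T Z → m + 1 + #R ≤ 2 * Fintype.card ι + #Z := by
    intro R hR hRsub
    have hdis : Disjoint (univ.image fun e => flipAt e t) R := by
      rw [Finset.disjoint_left]
      intro w hw hwR
      obtain ⟨e, -, rfl⟩ := mem_image.1 hw
      exact hR _ hwR e rfl
    have h1 : #(univ.image fun e => flipAt e t) = m + 1 := by
      rw [card_image_of_injective _ (flipAt_left_injective t)]
      simp
    have h2 : #(univ.image fun e => flipAt e t) + #R ≤ 2 * Fintype.card ι + #Z := by
      rw [← card_union_of_disjoint hdis]
      refine (card_le_card (union_subset (fun w hw => ?_) hRsub)).trans card_points_le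
      obtain ⟨e, -, rfl⟩ := mem_image.1 hw
      exact hall e
    rwa [h1] at h2
  have hs : ∀ e, flipAt e t ≠ s := fun e h' => by
    have := hd e
    rw [h', hst] at this
    omega
  have hst' : s ≠ t := h.injective.ne (by simp)
  rcases h.card with hc | ⟨hc, h5, z, hz⟩
  · have := hsub {s, t} (by simpa using ⟨hs, fun e => flipAt_ne_self e t⟩)
      (by simp [insert_subset_iff, s, t, mem_points_left])
    rw [card_pair hst'] at this
    omega
  -- Two antipodal vertices cannot both be neighbours of `t`. So `z'`, `s` and `t` are three points
  -- besides the `m + 1` neighbours of `t`, one more than the count allows.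
  · obtain ⟨z', hz', hzt⟩ : ∃ z' ∈ Z, ∀ e, flipAt e t ≠ z' := by
      by_contra! hcon
      obtain ⟨e, he⟩ := hcon z (by simp [hz])
      obtain ⟨f, hf⟩ := hcon (opposite z) (by simp [hz])
      have d1 := hd e
      have d2 := hd f
      have d3 := hammingDist_triangle z t (opposite z)
      rw [he, hammingDist_comm] at d1
      rw [hf] at d2
      rw [hammingDist_opposite] at d3
      omega
    have := hsub {z', s, t} (by simpa using ⟨hzt, hs, fun e => flipAt_ne_self e t⟩)
      (by simp [insert_subset_iff, s, t, mem_points_left, mem_points_right hz'])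
    rw [card_insert_of_notMem, card_pair hst'] at this
    · have h2 : #Z ≤ 2 := hz ▸ card_le_two
      omega
    · simp only [mem_insert, mem_singleton, not_or]
      exact ⟨fun h' => h.notMem _ (h' ▸ hz'), fun h' => h.notMem _ (h' ▸ hz')⟩

/-- The terminals outside the pair `i₀` on the side of that pair which cannot leave that side
directly. -/
def conflicts [DecidableEq ι] (T : ι × Bool → Fin (m + 1) → Bool)
    (Z : Finset (Fin (m + 1) → Bool)) (e : Fin (m + 1)) (i₀ : ι) : Finset (ι × Bool) :=
  univ.filter fun p => p.1 ≠ i₀ ∧ T p e = T (i₀, false) e ∧ flipAt e (T p) ∈ points T Z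

variable [DecidableEq ι] {i₀ : ι}

theorem mem_conflicts {p : ι × Bool} : p ∈ conflicts T Z e i₀ ↔
    p.1 ≠ i₀ ∧ T p e = T (i₀, false) e ∧ flipAt e (T p) ∈ points T Z := by
  simp [conflicts]

namespace IsSparse

/-- A conflicting terminal and the point across from it have the same projection, so every conflict
lowers the size of the shadow by one. -/
theorem card_shadow_add_card_conflicts_le (h : IsSparse T Z) (e : Fin (m + 1)) (i₀ : ι) :
    #(shadow T Z e (T (i₀, false) e)) + #(conflicts T Z e i₀) ≤ 2 * Fintype.card ι + #Z := by
  set b := T (i₀, false) e with hb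
  set B := (conflicts T Z e i₀).image fun p => flipAt e (T p) with hB
  have hBsub : B ⊆ points T Z := by
    intro w hw
    obtain ⟨p, hp, rfl⟩ := mem_image.1 hw
    exact (mem_conflicts.1 hp).2.2
  have hBcard : #B = #(conflicts T Z e i₀) :=
    card_image_of_injective _ fun p q hpq => h.injective (flipAt_injective e hpq)
  have hBe : ∀ w ∈ B, w e ≠ b := by
    intro w hw
    obtain ⟨p, hp, rfl⟩ := mem_image.1 hw
    rw [flipAt_same, (mem_conflicts.1 hp).2.1, ← hb]
    cases b <;> simp
  have hsub : shadow T Z e b ⊆ (points T Z \ B).image fun w => Function.update w e b := by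
    intro v hv
    obtain ⟨w, hw, rfl⟩ := mem_image.1 hv
    by_cases hwB : w ∈ B
    · obtain ⟨p, hp, rfl⟩ := mem_image.1 hwB
      have hpb := (mem_conflicts.1 hp).2.1
      refine mem_image.2 ⟨T p, mem_sdiff.2 ⟨mem_points_left p, fun h' => hBe _ h' hpb⟩, ?_⟩
      simp only [update_flipAt_same]
    · exact mem_image.2 ⟨w, mem_sdiff.2 ⟨hw, hwB⟩, rfl⟩
  have h1 := (card_le_card hsub).trans card_image_le
  rw [card_sdiff_of_subset hBsub] at h1
  have h2 := card_le_card hBsub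
  have h3 := card_points_le (T := T) (Z := Z)
  omega

end IsSparse

/-- The vertices of `R` belong to the obstacle set `P` but block no neighbour of `x`, so each of
them improves the lower bound on free neighbours. -/
theorem add_card_le_card_nbrs_sdiff {x : Fin (m + 1) → Bool} {P R : Finset (Fin (m + 1) → Bool)}
    (hR : R ⊆ P) (hRx : Disjoint R (nbrs e x)) : m + #R ≤ #(nbrs e x \ P) + #P := by
  have h := card_le_card
    (union_subset (hR.trans subset_union_right) subset_union_left : R ∪ nbrs e x ⊆ nbrs e x ∪ P)
  rw [card_union_of_disjoint hRx, card_nbrs] at h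
  rw [card_sdiff_add_card]
  omega

namespace IsSparse

/-- The conflicting terminals can be moved to distinct neighbours in their facet, unless there is
only one of them, and it is blocked. -/
theorem exists_moves (h : IsSparse T Z) (e : Fin (m + 1)) (i₀ : ι) :
    (∃ f : ι × Bool → Fin (m + 1) → Bool,
      (∀ p ∈ conflicts T Z e i₀, f p ∈ nbrs e (T p) \ shadow T Z e (T (i₀, false) e)) ∧
      Set.InjOn f (conflicts T Z e i₀)) ∨
    ∃ p, conflicts T Z e i₀ = {p} ∧ nbrs e (T p) ⊆ shadow T Z e (T (i₀, false) e) := by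
  by_cases hfail : ∃ p, conflicts T Z e i₀ = {p} ∧ nbrs e (T p) ⊆ shadow T Z e (T (i₀, false) e)
  · exact Or.inr hfail
  left
  set P := shadow T Z e (T (i₀, false) e) with hP
  have hcount := h.card_shadow_add_card_conflicts_le e i₀
  rw [← hP] at hcount
  have hshadow : ∀ {p q : ι × Bool} {E}, E ⊆ Z → T p e = T (i₀, false) e →
      T q e = T (i₀, false) e →
      insert (T p) (insert (T q) (E.image fun z => Function.update z e (T p e))) ⊆ P := by
    intro p q E hE hp hq w hw
    simp only [mem_insert, mem_image] at hw
    rcases hw with rfl | rfl | ⟨z, hz, rfl⟩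
    · exact mem_shadow_of_apply (mem_points_left p) hp
    · exact mem_shadow_of_apply (mem_points_left q) hq
    · rw [hp]; exact update_mem_shadow (mem_points_right (hE hz)) _
  have hEcard : ∀ {E : Finset (Fin (m + 1) → Bool)} {b}, #E ≤ 1 →
      #(E.image fun z => Function.update z e b) = #E := by
    intro E b hE
    exact card_image_of_injOn fun x hx y hy _ => card_le_one.1 hE x hx y hy
  have hself : ∀ x : Fin (m + 1) → Bool, x ∉ nbrs e x := fun x hx => by
    obtain ⟨f, -, hf⟩ := mem_nbrs.1 hx
    exact flipAt_ne_self f x hf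
  have key : ∀ p ∈ conflicts T Z e i₀, #(conflicts T Z e i₀) ≤ #(nbrs e (T p) \ P) + 1 := by
    intro p hp
    obtain ⟨-, hpb, -⟩ := mem_conflicts.1 hp
    obtain ⟨E, hEZ, hE1, hE, hEp, hEn, -⟩ := h.exists_far e p p
    rw [or_self] at hEn
    have h1 := add_card_le_card_nbrs_sdiff (e := e) (x := T p) (hshadow hEZ hpb hpb) (by
      rw [Finset.disjoint_left]
      intro w hw
      simp only [mem_insert, mem_image] at hw
      rcases hw with rfl | rfl | ⟨z, hz, rfl⟩
      exacts [hself _, hself _, hEn z hz])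
    rw [insert_eq_of_mem (mem_insert_self _ _), card_insert_of_notMem, hEcard hE1] at h1
    · omega
    · simp only [mem_image, not_exists, not_and]
      exact fun z hz => (hEp z hz).1
  refine Finset.exists_injOn_of_card_le_union _ _ key ?_ ?_
  · intro p hp q hq hpq
    obtain ⟨-, hpb, -⟩ := mem_conflicts.1 hp
    obtain ⟨-, hqb, -⟩ := mem_conflicts.1 hq
    -- Adjacent terminals have disjoint neighbourhoods, which doubles the bound of `key`. For
    -- nonadjacent ones, the other terminal is an obstacle that blocks no neighbour, which gains the
    -- missing one.
    by_cases hadj : T q ∈ nbrs e (T p)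
    · rw [card_union_of_disjoint ((disjoint_nbrs hadj).mono sdiff_subset sdiff_subset)]
      have := key p hp
      have := key q hq
      have : 2 ≤ #(conflicts T Z e i₀) := by
        rw [← card_pair hpq]
        exact card_le_card (by simp [insert_subset_iff, hp, hq])
      omega
    · obtain ⟨E, hEZ, hE1, hE, hEp, hEn, -⟩ := h.exists_far e p q
      have hR : #(insert (T p) (insert (T q) (E.image fun z => Function.update z e (T p e)))) =
          #E + 2 := by
        rw [card_insert_of_notMem, card_insert_of_notMem, hEcard hE1]
        · simp only [mem_image, not_exists, not_and]
          exact fun z hz => (hEp z hz).2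
        · simp only [mem_insert, mem_image, not_or, not_exists, not_and]
          exact ⟨h.injective.ne hpq, fun z hz => (hEp z hz).1⟩
      rcases hEn with hEn | hEn
      · have h1 := add_card_le_card_nbrs_sdiff (e := e) (x := T p) (hshadow hEZ hpb hqb) (by
          rw [Finset.disjoint_left]
          intro w hw
          simp only [mem_insert, mem_image] at hw
          rcases hw with rfl | rfl | ⟨z, hz, rfl⟩
          exacts [hself _, hadj, hEn z hz])
        have := card_le_card (subset_union_left (s₁ := nbrs e (T p) \ P) (s₂ := nbrs e (T q) \ P))
        omega
      · have h1 := add_card_le_card_nbrs_sdiff (e := e) (x := T q) (hshadow hEZ hpb hqb) (by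
          rw [Finset.disjoint_left]
          intro w hw
          simp only [mem_insert, mem_image] at hw
          rcases hw with rfl | rfl | ⟨z, hz, rfl⟩
          exacts [fun h' => hadj (mem_nbrs_comm.1 h'), hself _, hEn z hz])
        have := card_le_card (subset_union_right (s₁ := nbrs e (T p) \ P) (s₂ := nbrs e (T q) \ P))
        omega
  · intro p hp
    rw [sdiff_nonempty]
    exact fun hsub => hfail ⟨p, hp, hsub⟩

/-- If the only conflicting terminal `T p` is blocked, then, apart from at most one forbidden
vertex, all terminals and forbidden vertices project to `T p` and its neighbours, and to distinct
neighbours. -/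
theorem blocked_structure (h : IsSparse T Z) {p : ι × Bool} (hC : conflicts T Z e i₀ = {p})
    (hN : nbrs e (T p) ⊆ shadow T Z e (T p e)) :
    ∃ E ⊆ Z, (∀ z ∈ E, 5 ≤ m ∧ opposite z ∈ Z \ E) ∧
      (∀ w ∈ points T Z \ E, Function.update w e (T p e) ∈ insert (T p) (nbrs e (T p))) ∧
      ∀ w ∈ points T Z \ E, ∀ w' ∈ points T Z \ E, Function.update w e (T p e) ≠ T p →
        Function.update w e (T p e) = Function.update w' e (T p e) → w = w' := by
  obtain ⟨-, -, hflip⟩ := mem_conflicts.1 (hC ▸ mem_singleton_self p)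
  obtain ⟨E, hEZ, hE1, hE, hEp, hEn, hE5⟩ := h.exists_far e p p
  rw [or_self] at hEn
  set x := T p with hx
  have hxx : Function.update x e (x e) = x := Function.update_eq_self e x
  have hfx : Function.update (flipAt e x) e (x e) = x := by rw [update_flipAt_same, hxx]
  have hfmem : flipAt e x ∈ points T Z \ E :=
    mem_sdiff.2 ⟨hflip, fun h' => (hEp _ h').1 hfx⟩
  have hxmem : x ∈ points T Z \ E :=
    mem_sdiff.2 ⟨mem_points_left p, fun h' => h.notMem p (hEZ h')⟩
  have hself : x ∉ nbrs e x := fun hx => by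
    obtain ⟨f, -, hf⟩ := mem_nbrs.1 hx
    exact flipAt_ne_self f x hf
  -- At most `m + 1` points remain in `A`, and their projections cover `x` and its `m` neighbours.
  -- Hence projection is a bijection from `A` onto these vertices.
  set A := (points T Z \ E).erase (flipAt e x) with hA
  have hAcard : #A ≤ m + 1 := by
    rw [hA, card_erase_of_mem hfmem, card_sdiff_of_subset
      (hEZ.trans fun z hz => mem_points_right hz)]
    have := card_points_le (T := T) (Z := Z)
    omega
  have hsub : insert x (nbrs e x) ⊆ A.image fun w => Function.update w e (x e) := by
    intro y hy
    rcases mem_insert.1 hy with hyx | hy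
    · rw [hyx]
      exact mem_image.2 ⟨x, mem_erase.2 ⟨(flipAt_ne_self e x).symm, hxmem⟩, hxx⟩
    · obtain ⟨w, hw, rfl⟩ := mem_image.1 (hN hy)
      refine mem_image.2 ⟨w, mem_erase.2 ⟨?_, mem_sdiff.2 ⟨hw, fun h' => hEn w h' hy⟩⟩, rfl⟩
      intro hwx
      rw [hwx, hfx] at hy
      exact hself hy
  have hNcard : #(insert x (nbrs e x)) = m + 1 := by
    rw [card_insert_of_notMem hself, card_nbrs]
  have himage : insert x (nbrs e x) = A.image fun w => Function.update w e (x e) :=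
    eq_of_subset_of_card_le hsub (card_image_le.trans (hAcard.trans hNcard.ge))
  have hinj : Set.InjOn (fun w : Fin (m + 1) → Bool => Function.update w e (x e))
      (A : Set (Fin (m + 1) → Bool)) :=
    card_image_iff.1 (le_antisymm card_image_le (by rw [← himage, hNcard]; exact hAcard))
  refine ⟨E, hEZ, hE5, fun w hw => ?_, fun w hw w' hw' hne heq => ?_⟩
  · by_cases hwf : w = flipAt e x
    · rw [hwf, hfx]; exact mem_insert_self _ _
    · rw [himage]
      exact mem_image_of_mem _ (mem_erase.2 ⟨hwf, hw⟩)
  · refine hinj (mem_erase.2 ⟨?_, hw⟩) (mem_erase.2 ⟨?_, hw'⟩) heq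
    · intro hwx; exact hne (hwx ▸ hfx)
    · intro hwx; exact hne (heq.trans (hwx ▸ hfx))

end IsSparse

end

end BoolCube

/-! ### Splitting along a direction: a linkage, a blocked terminal or an isolated end. -/

namespace BoolCube

open Finset

variable {m : ℕ} {ι : Type*} [Fintype ι] [DecidableEq ι] {T : ι × Bool → Fin (m + 1) → Bool}
  {Z : Finset (Fin (m + 1) → Bool)} {e : Fin (m + 1)} {i₀ : ι}

/-- Linkages of one pair less exist in the `m`-cube. -/
def LinksFewer (m : ℕ) {ι : Type*} [Fintype ι] (i₀ : ι) : Prop :=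
  ∀ (W : Finset (Fin m → Bool)) (T : {i // i ≠ i₀} × Bool → Fin m → Bool), Function.Injective T →
    (∀ p, T p ∉ W) → 2 * Fintype.card ι + #W ≤ m + 3 → (cube m).LinkedAvoiding T W

/-- The terminals outside the pair `i₀` that lie on the side of this pair. -/
def nearTerminals (T : ι × Bool → Fin (m + 1) → Bool) (e : Fin (m + 1)) (i₀ : ι) :
    Finset (ι × Bool) := univ.filter fun p => p.1 ≠ i₀ ∧ T p e = T (i₀, false) e

theorem mem_nearTerminals {p : ι × Bool} :
    p ∈ nearTerminals T e i₀ ↔ p.1 ≠ i₀ ∧ T p e = T (i₀, false) e := by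
  simp [nearTerminals]

theorem card_filter_fst_ne (i₀ : ι) :
    #(univ.filter fun p : ι × Bool => p.1 ≠ i₀) + 2 = 2 * Fintype.card ι := by
  have h : (univ.filter fun p : ι × Bool => p.1 ≠ i₀) = (univ.erase i₀) ×ˢ univ := by
    ext p; simp
  have : 0 < Fintype.card ι := Fintype.card_pos_iff.2 ⟨i₀⟩
  rw [h, card_product, card_erase_of_mem (mem_univ _), card_univ, card_univ, Fintype.card_bool]
  omega

theorem card_nearTerminals_add_two_le : #(nearTerminals T e i₀) + 2 ≤ 2 * Fintype.card ι := by
  rw [← card_filter_fst_ne i₀]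
  refine Nat.add_le_add_right (card_le_card fun p hp => ?_) _
  simpa using (mem_nearTerminals.1 hp).1

namespace IsSparse

/-- If all neighbours of `a` are terminals, forbidden vertices or vertices occupied by moved
terminals, then all terminals outside the pair `i₀` are neighbours of `a`, and none of them is
moved. -/
theorem nbrs_eq_of_subset (h : IsSparse T Z) (ht : T (i₀, true) e = T (i₀, false) e ∨
      Function.update (T (i₀, true)) e (T (i₀, false) e) ∉ points T Z)
    {y : ι × Bool → Fin (m + 1) → Bool}
    (hy : ∀ p ∈ conflicts T Z e i₀, y p ∈ nbrs e (T p))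
    (hy' : ∀ p ∈ nearTerminals T e i₀, p ∉ conflicts T Z e i₀ → y p = T p)
    {a : Fin (m + 1) → Bool}
    (ha : nbrs e a ⊆ Z.filter (· e = T (i₀, false) e) ∪
      (nearTerminals T e i₀).biUnion fun p => {T p, y p}) :
    (∀ p, p.1 ≠ i₀ → T p e = T (i₀, false) e) ∧
      nbrs e a = Z.filter (· e = T (i₀, false) e) ∪ (nearTerminals T e i₀).image T := by
  set b := T (i₀, false) e with hb
  set Z₀ := Z.filter (· e = b) with hZ₀
  set X₀ := nearTerminals T e i₀ with hX₀
  -- By parity the adjacent vertices `T p` and `y p` are not both neighbours of `a`. So the `m`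
  -- neighbours of `a` need at least `m` near terminals and near forbidden vertices, which is also
  -- the most available; equality then holds throughout.
  have hle1 : ∀ p ∈ X₀, #(nbrs e a ∩ {T p, y p}) ≤ 1 := by
    intro p hp
    by_cases hpC : p ∈ conflicts T Z e i₀
    · have hn := hy p hpC
      rw [card_le_one]
      have hdis : T p ∈ nbrs e a → y p ∈ nbrs e a → False := fun h1 h2 =>
        Finset.disjoint_left.1 (disjoint_nbrs h1) h2 hn
      intro u hu w hw
      simp only [mem_inter, mem_insert, mem_singleton] at hu hw
      obtain ⟨hu, rfl | rfl⟩ := hu <;> obtain ⟨hw, rfl | rfl⟩ := hw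
      · rfl
      · exact (hdis hu hw).elim
      · exact (hdis hw hu).elim
      · rfl
    · rw [hy' p hp hpC, pair_eq_singleton]
      exact (card_le_card inter_subset_right).trans (card_singleton _).le
  have hm : m ≤ #(nbrs e a ∩ Z₀) + ∑ p ∈ X₀, #(nbrs e a ∩ {T p, y p}) := by
    calc m = #(nbrs e a) := (card_nbrs e a).symm
      _ ≤ #((nbrs e a ∩ Z₀) ∪ X₀.biUnion fun p => nbrs e a ∩ {T p, y p}) := by
          refine card_le_card fun w hw => ?_
          rcases mem_union.1 (ha hw) with hw' | hw'
          · exact mem_union_left _ (mem_inter.2 ⟨hw, hw'⟩)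
          · obtain ⟨p, hp, hw'⟩ := mem_biUnion.1 hw'
            exact mem_union_right _ (mem_biUnion.2 ⟨p, hp, mem_inter.2 ⟨hw, hw'⟩⟩)
      _ ≤ _ := (card_union_le _ _).trans (Nat.add_le_add_left card_biUnion_le _)
  have hsum : ∑ p ∈ X₀, #(nbrs e a ∩ {T p, y p}) ≤ #X₀ := by
    simpa using Finset.sum_le_sum hle1
  have hZle : #(nbrs e a ∩ Z₀) ≤ #Z₀ := card_le_card inter_subset_right
  have hbound := h.card_filter_le e b
  rw [← hZ₀] at hbound
  have hX₀card : #X₀ + 2 ≤ 2 * Fintype.card ι := card_nearTerminals_add_two_le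
  have hall : ∀ p, p.1 ≠ i₀ → T p e = b := by
    intro p hp
    by_contra hpb
    have : #X₀ < #(univ.filter fun p : ι × Bool => p.1 ≠ i₀) := by
      refine card_lt_card ⟨fun q hq => by simpa using (mem_nearTerminals.1 hq).1, fun hsub => ?_⟩
      exact hpb (mem_nearTerminals.1 (hsub (mem_filter.2 ⟨mem_univ p, hp⟩))).2
    have := card_filter_fst_ne i₀
    omega
  have hZsub : Z₀ ⊆ nbrs e a := by
    rw [← inter_eq_right]
    exact eq_of_subset_of_card_le inter_subset_right (by omega)
  have hone : ∀ p ∈ X₀, T p ∈ nbrs e a ∨ y p ∈ nbrs e a := by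
    intro p hp
    by_contra hnot
    have hlt : ∑ p ∈ X₀, #(nbrs e a ∩ {T p, y p}) < ∑ p ∈ X₀, 1 := by
      refine Finset.sum_lt_sum hle1 ⟨p, hp, ?_⟩
      rw [Nat.lt_one_iff, card_eq_zero, eq_empty_iff_forall_notMem]
      intro w hw
      simp only [mem_inter, mem_insert, mem_singleton] at hw
      obtain ⟨hw, rfl | rfl⟩ := hw
      exacts [hnot (Or.inl hw), hnot (Or.inr hw)]
    simp only [sum_const, smul_eq_mul, mul_one] at hlt
    omega
  -- The point across from a conflicting terminal would have to be forbidden. In the first case of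
  -- `IsSparse` this breaks the equality in the count. In the second its opposite is a neighbour of
  -- `a`, while the point itself is within distance three of `a`, so `m + 1 ≤ 4`.
  have hC : ∀ p, p ∉ conflicts T Z e i₀ := by
    intro p hp
    obtain ⟨hp0, hpb, hmem⟩ := mem_conflicts.1 hp
    have hfe : flipAt e (T p) e ≠ b := by
      rw [flipAt_same, hpb, ← hb]; cases b <;> simp
    rcases mem_points.1 hmem with ⟨⟨i, c⟩, hq⟩ | hz
    · by_cases hi : i = i₀
      · subst hi
        cases c
        · rw [← hq] at hfe; exact hfe rfl
        · rcases ht with ht | ht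
          · rw [← hq] at hfe; exact hfe ht
          · rw [hq, update_flipAt_same, update_eq_self_of_apply hpb] at ht
            exact ht (mem_points_left p)
      · rw [← hq] at hfe; exact hfe (hall (i, c) hi)
    · rcases h.card with hc | ⟨-, h5, z, hz'⟩
      · have hlt : #Z₀ < #Z := card_lt_card ⟨filter_subset _ _, fun hsub =>
          hfe (mem_filter.1 (hsub hz)).2⟩
        omega
      · have hopp : opposite (flipAt e (T p)) ∈ Z₀ := by
          refine mem_filter.2 ⟨?_, ?_⟩
          · rw [hz'] at hz ⊢
            simp only [mem_insert, mem_singleton] at hz ⊢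
            rcases hz with hz | hz <;> rw [hz] <;> simp [opposite_opposite]
          · simp [opposite, hpb, hb]
        have d1 := hammingDist_le_of_mem_nbrs (hZsub hopp)
        have d2 : hammingDist a (T p) ≤ 2 := by
          rcases hone p (mem_nearTerminals.2 ⟨hp0, hpb⟩) with h' | h'
          · have := hammingDist_le_of_mem_nbrs h'
            omega
          · have d3 := hammingDist_le_of_mem_nbrs h'
            have d4 := hammingDist_le_of_mem_nbrs (hy p hp)
            have d5 := hammingDist_triangle a (y p) (T p)
            rw [hammingDist_comm] at d4
            omega
        have d6 := hammingDist_le_of_adj_flipAt (y := a) (e := e) (x := T p) rfl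
        have d7 := hammingDist_triangle (flipAt e (T p)) a (opposite (flipAt e (T p)))
        rw [hammingDist_opposite, hammingDist_comm _ a] at d7
        omega
  have hyT : ∀ p ∈ X₀, y p = T p := fun p hp => hy' p hp (hC p)
  refine ⟨hall, Subset.antisymm (fun w hw => ?_) (union_subset hZsub fun w hw => ?_)⟩
  · rcases mem_union.1 (ha hw) with hw' | hw'
    · exact mem_union_left _ hw'
    · obtain ⟨p, hp, hw'⟩ := mem_biUnion.1 hw'
      rw [hyT p hp, pair_eq_singleton, mem_singleton] at hw'
      exact mem_union_right _ (mem_image.2 ⟨p, hp, hw'.symm⟩)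
  · obtain ⟨p, hp, rfl⟩ := mem_image.1 hw
    have := hone p hp
    rwa [hyT p hp, or_self] at this

/-- Linking the pair `i₀` on one side of the direction `e` and all other pairs on the other side
works, unless a terminal is blocked. -/
theorem linked_or_blocked_or_isolated (h : IsSparse T Z) (ih : LinksFewer m i₀)
    (ht : T (i₀, true) e = T (i₀, false) e ∨
      Function.update (T (i₀, true)) e (T (i₀, false) e) ∉ points T Z) :
    (cube (m + 1)).LinkedAvoiding T Z ∨
    (∃ p, conflicts T Z e i₀ = {p} ∧ nbrs e (T p) ⊆ shadow T Z e (T (i₀, false) e)) ∨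
    ((∀ p, p.1 ≠ i₀ → T p e = T (i₀, false) e) ∧
      ∃ a, (a = T (i₀, false) ∨ a = Function.update (T (i₀, true)) e (T (i₀, false) e)) ∧
        nbrs e a = Z.filter (· e = T (i₀, false) e) ∪ (nearTerminals T e i₀).image T) := by
  rcases h.exists_moves e i₀ with ⟨f, hf, hfinj⟩ | hblock
  swap
  · exact Or.inr (Or.inl hblock)
  set b := T (i₀, false) e with hb
  set C := conflicts T Z e i₀ with hC
  set P := shadow T Z e b with hP
  set t' := Function.update (T (i₀, true)) e b with ht'
  -- The place in the facet of the pair `i₀` from or to which each terminal uses its edge in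
  -- direction `e`: the chosen neighbour for a conflict, the projection otherwise.
  set y : ι × Bool → Fin (m + 1) → Bool :=
    fun p => if p ∈ C then f p else Function.update (T p) e b with hy
  set Z₀ := Z.filter (· e = b) with hZ₀
  set S := Z₀ ∪ (nearTerminals T e i₀).biUnion (fun p => {T p, y p}) with hS
  have hyC : ∀ p ∈ C, y p ∈ nbrs e (T p) ∧ y p ∉ P := fun p hp => by
    simpa only [hy, if_pos hp, mem_sdiff] using hf p hp
  have hyn : ∀ p, p ∉ C → y p = Function.update (T p) e b := fun p hp => by simp only [hy, if_neg hp]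
  have hynear : ∀ p, T p e = b → p ∉ C → y p = T p := fun p hp hpC => by
    rw [hyn p hpC, update_eq_self_of_apply hp]
  have hyP : ∀ p, p ∉ C → y p ∈ P := fun p hp => by
    rw [hyn p hp]; exact update_mem_shadow (mem_points_left p) b
  have hCb : ∀ p ∈ C, p.1 ≠ i₀ ∧ T p e = b ∧ flipAt e (T p) ∈ points T Z :=
    fun p hp => mem_conflicts.1 hp
  have hyb : ∀ p, y p e = b := fun p => by
    by_cases hp : p ∈ C
    · rw [nbrs_apply_same (hyC p hp).1, (hCb p hp).2.1]
    · rw [hyn p hp]; simp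
  have ht'P : t' ∈ P := update_mem_shadow (mem_points_left _) b
  have hsP : T (i₀, false) ∈ P := mem_shadow_of_apply (mem_points_left _) rfl
  have hst : t' ≠ T (i₀, false) := by
    rcases ht with ht | ht
    · rw [ht', update_eq_self_of_apply ht]
      exact h.injective.ne (by simp)
    · exact fun h' => ht (h' ▸ mem_points_left _)
  have ht'Z : t' ∉ Z := by
    rcases ht with ht | ht
    · rw [ht', update_eq_self_of_apply ht]
      exact h.notMem _
    · exact fun h' => ht (mem_points_right h')
  have ht'T : ∀ p, p.1 ≠ i₀ → T p ≠ t' := by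
    intro p hp h'
    rcases ht with ht | ht
    · rw [ht', update_eq_self_of_apply ht] at h'
      exact hp (congrArg Prod.fst (h.injective h'))
    · exact ht (h' ▸ mem_points_left p)
  have hSmem : ∀ w, w ∈ S ↔ (w ∈ Z ∧ w e = b) ∨
      ∃ p, (p.1 ≠ i₀ ∧ T p e = b) ∧ (w = T p ∨ w = y p) := by
    intro w
    simp only [hS, hZ₀, mem_union, mem_filter, mem_biUnion, mem_nearTerminals, mem_insert,
      mem_singleton, ← hb]
  -- Obstacles lie in the shadow, minus the two ends to be joined, or are new positions of
  -- conflicts. The new positions are offset by the loss of shadow that conflicts cause.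
  have hSsub : S ⊆ (P.erase (T (i₀, false))).erase t' ∪ C.image f := by
    intro w hw
    rcases (hSmem w).1 hw with ⟨hwZ, hwb⟩ | ⟨p, ⟨hp, hpb⟩, hw⟩
    · refine mem_union_left _ (mem_erase.2 ⟨fun h' => ht'Z (h' ▸ hwZ), mem_erase.2
        ⟨fun h' => h.notMem _ (h' ▸ hwZ), mem_shadow_of_apply (mem_points_right hwZ) hwb⟩⟩)
    · have hTp : T p ∈ (P.erase (T (i₀, false))).erase t' :=
        mem_erase.2 ⟨ht'T p hp, mem_erase.2 ⟨h.injective.ne fun h' => hp (congrArg Prod.fst h'),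
          mem_shadow_of_apply (mem_points_left p) hpb⟩⟩
      rcases hw with rfl | rfl
      · exact mem_union_left _ hTp
      · by_cases hpC : p ∈ C
        · refine mem_union_right _ (mem_image.2 ⟨p, hpC, by simp only [hy, if_pos hpC]⟩)
        · rw [hynear p hpb hpC]
          exact mem_union_left _ hTp
  have hSP : ∀ w ∈ P, (w = T (i₀, false) ∨ w = t') → w ∉ S := by
    intro w hwP hw hwS
    rcases mem_union.1 (hSsub hwS) with h' | h'
    · simp only [mem_erase] at h'
      rcases hw with hw | hw
      exacts [h'.2.1 hw, h'.1 hw]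
    · obtain ⟨p, hp, rfl⟩ := mem_image.1 h'
      exact (mem_sdiff.1 (hf p hp)).2 hwP
  have hcard := h.card_shadow_add_card_conflicts_le e i₀
  rw [← hb, ← hP, ← hC] at hcard
  have hScard : #S + 2 ≤ 2 * Fintype.card ι + #Z := by
    have h1 := (card_le_card hSsub).trans ((card_union_le _ _).trans
      (Nat.add_le_add_left card_image_le _))
    have h2 : #((P.erase (T (i₀, false))).erase t') + 2 = #P := by
      rw [← card_erase_add_one hsP, ← card_erase_add_one (mem_erase.2 ⟨hst, ht'P⟩)]
    omega
  -- The two cases give `#S ≤ m` and `#S ≤ m + 1`, so `3 ≤ m` and `5 ≤ m` suffice respectively.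
  have hS3 : #S + 3 ≤ 2 * m := by
    have := h.three_le
    rcases h.card with hc | ⟨hc, h5, z, rfl⟩
    · omega
    · have := card_le_two (a := z) (b := opposite z)
      omega
  by_cases hiso : ∃ a, (a = T (i₀, false) ∨ a = t') ∧ nbrs e a ⊆ S
  · obtain ⟨a, ha, haS⟩ := hiso
    obtain ⟨h1, h2⟩ := h.nbrs_eq_of_subset (e := e) (i₀ := i₀) (y := y) ht (fun p hp => (hyC p hp).1)
      (fun p hp hpC => hynear p (mem_nearTerminals.1 hp).2 hpC) haS
    exact Or.inr (Or.inr ⟨h1, a, ha, h2⟩)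
  push Not at hiso
  left
  have hpath := joinedIn_facet_of_not_subset e S hS3 (x := T (i₀, false)) (y := t')
    (by simp [ht', hb]) (hSP _ hsP (Or.inl rfl)) (hSP _ ht'P (Or.inr rfl))
    (hiso _ (Or.inl rfl)) (hiso _ (Or.inr rfl))
  have hyinj : ∀ p q, p.1 ≠ i₀ → q.1 ≠ i₀ → y p = y q → p = q := by
    -- An unmoved near terminal directly across from a far one would be a conflict.
    have mixed : ∀ p q, p.1 ≠ i₀ → p ∉ C → q ∉ C → T p e = b → T q e ≠ b → y p ≠ y q := by
      intro p q hp hpC hqC hpb hqb h'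
      rw [hynear p hpb hpC, hyn q hqC] at h'
      refine hpC (mem_conflicts.2 ⟨hp, hpb, ?_⟩)
      rw [h', ← eq_flipAt_update hqb]
      exact mem_points_left q
    intro p q hp hq hpq
    by_cases hpC : p ∈ C <;> by_cases hqC : q ∈ C
    · refine hfinj hpC hqC ?_
      simpa only [hy, if_pos hpC, if_pos hqC] using hpq
    · exact ((hyC p hpC).2 (hpq ▸ hyP q hqC)).elim
    · exact ((hyC q hqC).2 (hpq ▸ hyP p hpC)).elim
    · by_cases hpb : T p e = b <;> by_cases hqb : T q e = b
      · rw [hynear p hpb hpC, hynear q hqb hqC] at hpq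
        exact h.injective hpq
      · exact (mixed p q hp hpC hqC hpb hqb hpq).elim
      · exact (mixed q p hq hqC hpC hqb hpb hpq.symm).elim
      · rw [hyn p hpC, hyn q hqC] at hpq
        refine h.injective ?_
        rw [eq_flipAt_update hpb, eq_flipAt_update hqb, hpq]
  have hup : ∀ p, p.1 ≠ i₀ → flipAt e (y p) ∉ Z ∧ flipAt e (y p) ≠ T (i₀, true) := by
    intro p hp
    by_cases hpC : p ∈ C
    · have hne : ∀ w ∈ points T Z, flipAt e (y p) ≠ w := by
        rintro w hw rfl
        refine (hyC p hpC).2 ?_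
        have := update_mem_shadow (e := e) hw b
        rwa [update_flipAt_same, update_eq_self_of_apply (hyb p)] at this
      exact ⟨fun h' => hne _ (mem_points_right h') rfl, hne _ (mem_points_left _)⟩
    · by_cases hpb : T p e = b
      · rw [hynear p hpb hpC]
        have hne : flipAt e (T p) ∉ points T Z := fun h' => hpC (mem_conflicts.2 ⟨hp, hpb, h'⟩)
        exact ⟨fun h' => hne (mem_points_right h'), fun h' => hne (h' ▸ mem_points_left _)⟩
      · rw [hyn p hpC, ← eq_flipAt_update hpb]
        exact ⟨h.notMem p, h.injective.ne fun h' => hp (congrArg Prod.fst h')⟩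
  refine linkedAvoiding_of_landing (e := e) (i₀ := i₀) (b := b) (S := S) h.injective h.notMem y
    (fun p _ => hyb p) hyinj ?_ ?_ ?_ ?_ (fun z hz hzb => (hSmem z).2 (Or.inl ⟨hz, hzb⟩))
    (fun p hp hpb => ⟨(hSmem _).2 (Or.inr ⟨p, ⟨hp, hpb⟩, Or.inl rfl⟩),
      (hSmem _).2 (Or.inr ⟨p, ⟨hp, hpb⟩, Or.inr rfl⟩)⟩) hpath ?_
  · exact fun p _ hpb => hyn p fun hpC => hpb (hCb p hpC).2.1
  · intro p hp hpb
    by_cases hpC : p ∈ C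
    · exact Or.inr (adj_of_mem_nbrs (hyC p hpC).1)
    · exact Or.inl (hynear p hpb hpC).symm
  · intro p hp hpb
    by_cases hpC : p ∈ C
    · exact fun h' => (hyC p hpC).2 (mem_shadow_of_apply (mem_points_right h') (hyb p))
    · rw [hynear p hpb hpC]; exact h.notMem p
  · intro p hp hpb q hq hqb hpq
    by_cases hpC : p ∈ C
    · refine ((hyC p hpC).2 ?_).elim
      rw [hpq]
      exact mem_shadow_of_apply (mem_points_left q) hqb
    · rw [hynear p hpb hpC] at hpq
      exact h.injective hpq
  · refine linkedAvoiding_facet e (!b) (insert (T (i₀, true)) Z) (fun p => ?_) ?_ ?_ ?_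
    · simp only [flipAt_same, hyb]
    · rintro ⟨⟨i, hi⟩, c⟩ ⟨⟨j, hj⟩, c'⟩ hpq
      have := hyinj _ _ hi hj (flipAt_injective e hpq)
      simp only [Prod.mk.injEq] at this ⊢
      exact ⟨Subtype.ext this.1, this.2⟩
    · rintro ⟨⟨i, hi⟩, c⟩ hmem
      rcases mem_insert.1 hmem with h' | h'
      exacts [(hup (i, c) hi).2 h', (hup (i, c) hi).1 h']
    · intro W T' hT' hTW hW
      -- The far facet has to avoid its part of `Z` and possibly the second end of the pair `i₀`.
      -- This adds one to the bound `m + 2`, which gives the `m + 3` of `LinksFewer`, where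
      -- `Fintype.card ι` still counts the pair `i₀`.
      refine ih W T' hT' hTW ?_
      have h1 := h.card_filter_le e (!b)
      have h2 : #((insert (T (i₀, true)) Z).filter (· e = !b)) ≤ #(Z.filter (· e = !b)) + 1 := by
        rw [filter_insert]
        split_ifs
        · exact card_insert_le _ _
        · omega
      omega

end IsSparse

end BoolCube

/-! ### Choosing the pair and the direction; the induction. -/

namespace BoolCube

open Finset

variable {m : ℕ} {ι : Type*} [Fintype ι] [DecidableEq ι] {T : ι × Bool → Fin (m + 1) → Bool}
  {Z : Finset (Fin (m + 1) → Bool)} {e : Fin (m + 1)} {i₀ : ι}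

theorem hammingDist_le_two_of_update_mem {b : Bool} {x w : Fin (m + 1) → Bool}
    (hw : Function.update w e b ∈ insert x (nbrs e x)) : hammingDist x w ≤ 2 := by
  have d1 := hammingDist_triangle x (Function.update w e b) w
  have d2 := hammingDist_update_le e b w
  rw [hammingDist_comm] at d2
  rcases mem_insert.1 hw with h | h
  · rw [h, hammingDist_self] at d1
    rw [h] at d2
    omega
  · have := hammingDist_le_of_mem_nbrs h
    omega

namespace IsSparse

/-- By `blocked_structure`, `T (i₀, false)` is the neighbour of `T p` in some direction `g`, and
apart from `E` it is the only point that differs from `T p` in coordinate `g`. Splitting along `g`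
for the pair of `p` therefore succeeds: the point across from `T (i₀, false)` is `T p`, which
belongs to the chosen pair, so it causes no conflict, and its position on the other side rules out
isolation. -/
theorem linkedAvoiding_of_blocked (h : IsSparse T Z) (ih : ∀ i : ι, LinksFewer m i) {p : ι × Bool}
    (hp : conflicts T Z e i₀ = {p}) (hN : nbrs e (T p) ⊆ shadow T Z e (T (i₀, false) e)) :
    (cube (m + 1)).LinkedAvoiding T Z := by
  obtain ⟨hp0, hpb, hflip⟩ := mem_conflicts.1 (hp ▸ mem_singleton_self p)
  obtain ⟨E, hEZ, hE, hnear, hinj⟩ := h.blocked_structure hp (hpb ▸ hN)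
  have hTE : ∀ q, T q ∈ points T Z \ E := fun q =>
    mem_sdiff.2 ⟨mem_points_left q, fun h' => h.notMem q (hEZ h')⟩
  have hs := hnear _ (hTE (i₀, false))
  rw [update_eq_self_of_apply hpb.symm] at hs
  have hsx : T (i₀, false) ≠ T p := h.injective.ne fun h' => hp0 (congrArg Prod.fst h'.symm)
  obtain ⟨g, hg, hgs⟩ := mem_nbrs.1 ((mem_insert.1 hs).resolve_left hsx)
  have hside : ∀ w ∈ points T Z \ E, w ≠ T (i₀, false) → w g = T p g := by
    intro w hw hws
    by_contra hwg
    have hup : Function.update w e (T p e) g = w g := by simp [hg]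
    have hne : Function.update w e (T p e) ≠ T p := fun h' => hwg (by rw [← hup, h'])
    obtain ⟨f, hf, hfw⟩ := mem_nbrs.1 ((mem_insert.1 (hnear w hw)).resolve_left hne)
    by_cases hfg : g = f
    · subst hfg
      refine hws (hinj w hw _ (hTE (i₀, false)) hne ?_)
      rw [update_eq_self_of_apply hpb.symm, ← hgs, hfw]
    · refine hwg ?_
      rw [← hup, ← hfw, flipAt_of_ne hfg]
  have hpair : ∀ c, T (p.1, c) g = T p g := fun c =>
    hside _ (hTE _) (h.injective.ne fun h' => hp0 (congrArg Prod.fst h'))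
  rcases h.linked_or_blocked_or_isolated (e := g) (ih p.1)
    (Or.inl ((hpair true).trans (hpair false).symm)) with hl | ⟨q, hq, -⟩ | ⟨hall, -⟩
  · exact hl
  · exfalso
    obtain ⟨hq0, hqg, hqmem⟩ := mem_conflicts.1 (hq ▸ mem_singleton_self q)
    rw [hpair] at hqg
    have hne : flipAt g (T q) g ≠ T p g := by
      rw [flipAt_same, hqg]; cases T p g <;> simp
    -- If the point across from `T q` is in `E`, it is within distance three of `T p` and its
    -- opposite within two, so `m + 1 ≤ 5`, against `5 ≤ m`.
    by_cases hqE : flipAt g (T q) ∈ E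
    · obtain ⟨h5, hopp⟩ := hE _ hqE
      have d1 := hammingDist_le_two_of_update_mem (hnear _ (sdiff_subset_sdiff
        (fun z hz => mem_points_right hz) Subset.rfl hopp))
      have d2 := hammingDist_le_two_of_update_mem (hnear _ (hTE q))
      have d3 := hammingDist_le_of_adj_flipAt (y := T p) (e := g) (x := T q) rfl
      have d4 := hammingDist_triangle (flipAt g (T q)) (T p) (opposite (flipAt g (T q)))
      rw [hammingDist_opposite, hammingDist_comm _ (T p)] at d4
      omega
    · by_cases hqs : flipAt g (T q) = T (i₀, false)
      · rw [← hgs] at hqs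
        exact hq0 (congrArg Prod.fst (h.injective (flipAt_injective g hqs)))
      · exact hne (hside _ (mem_sdiff.2 ⟨hqmem, hqE⟩) hqs)
  · have := hall (i₀, false) (Ne.symm hp0)
    rw [hpair, ← hgs, flipAt_same] at this
    revert this
    cases T p g <;> simp

/-- If the pair `i₀` has an isolated end `a`, all other terminals lie on its side, so the pair `i₁`
can be tried along the same direction. If it also has an isolated end `a'`, then `a'` is a neighbour
of `a`, and the two neighbourhoods share a vertex, against parity. -/
theorem linkedAvoiding_of_apply_eq (h : IsSparse T Z) (ih : ∀ i : ι, LinksFewer m i) {i₁ : ι}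
    (hi : i₁ ≠ i₀) (hs : T (i₀, true) e = T (i₀, false) e) :
    (cube (m + 1)).LinkedAvoiding T Z := by
  rcases h.linked_or_blocked_or_isolated (ih i₀) (Or.inl hs) with
    hl | ⟨p, hp, hN⟩ | ⟨hall, a, ha, hNa⟩
  · exact hl
  · exact h.linkedAvoiding_of_blocked ih hp hN
  have hb₁ : T (i₁, false) e = T (i₀, false) e := hall _ hi
  have hs₁ : T (i₁, true) e = T (i₁, false) e := (hall (i₁, true) hi).trans hb₁.symm
  rcases h.linked_or_blocked_or_isolated (ih i₁) (Or.inl hs₁) with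
    hl | ⟨p, hp, hN⟩ | ⟨-, a', ha', hNa'⟩
  · exact hl
  · exact h.linkedAvoiding_of_blocked ih hp hN
  exfalso
  rw [update_eq_self_of_apply hs₁] at ha'
  obtain ⟨c, hc⟩ : ∃ c, a' = T (i₁, c) := by
    rcases ha' with ha' | ha'
    exacts [⟨_, ha'⟩, ⟨_, ha'⟩]
  have haa' : a' ∈ nbrs e a := by
    rw [hNa, hc]
    exact mem_union_right _ (mem_image_of_mem _ (mem_nearTerminals.2 ⟨hi, hall (i₁, c) hi⟩))
  -- Since `m ≥ 3`, some neighbour of `a` is not an end of the pair `i₁`. It is forbidden or belongs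
  -- to a third pair, so it is a neighbour of `a'` as well.
  obtain ⟨w, hw, hw'⟩ : ∃ w ∈ nbrs e a, w ∉ ({T (i₁, false), T (i₁, true)} : Finset _) := by
    by_contra! hsub
    have h1 := card_le_card hsub
    have h2 := card_le_two (a := T (i₁, false)) (b := T (i₁, true))
    have := h.three_le
    rw [card_nbrs] at h1
    omega
  refine Finset.disjoint_left.1 (disjoint_nbrs haa') hw ?_
  rw [hNa']
  rw [hNa] at hw
  rcases mem_union.1 hw with hw | hw
  · exact mem_union_left _ (by rwa [hb₁])
  · obtain ⟨⟨j, c'⟩, hq, rfl⟩ := mem_image.1 hw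
    refine mem_union_right _ (mem_image_of_mem _ (mem_nearTerminals.2 ⟨?_, ?_⟩))
    · rintro rfl
      revert hw'
      cases c' <;> simp
    · rw [(mem_nearTerminals.1 hq).2, hb₁]

theorem linkedAvoiding (h : IsSparse T Z) (hι : 2 ≤ Fintype.card ι)
    (ih : ∀ i : ι, LinksFewer m i) : (cube (m + 1)).LinkedAvoiding T Z := by
  obtain ⟨i₀, i₁, hi⟩ := Fintype.one_lt_card_iff.1 hι
  by_cases hns : ∃ i e, T (i, true) e = T (i, false) e
  · obtain ⟨i, e, hie⟩ := hns
    by_cases h0 : i₀ = i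
    · exact h.linkedAvoiding_of_apply_eq ih (i₁ := i₁) (fun h' => hi (h0.trans h'.symm)) hie
    · exact h.linkedAvoiding_of_apply_eq ih h0 hie
  -- From here on all pairs are antipodal. A blocked terminal would be within distance one of the
  -- first end of `i₀` and two of the second, so `m + 1 ≤ 3`; isolation would put both ends of `i₁`
  -- on one side of `e`.
  push Not at hns
  obtain ⟨e, he⟩ := h.exists_flipAt_notMem (hns i₀)
  have hup : Function.update (T (i₀, true)) e (T (i₀, false) e) = flipAt e (T (i₀, true)) := by
    have h1 := eq_flipAt_update (hns i₀ e)
    rw [h1, flipAt_flipAt, ← h1]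
  rcases h.linked_or_blocked_or_isolated (e := e) (ih i₀) (Or.inr (hup ▸ he)) with
    hl | ⟨p, hp, hN⟩ | ⟨hall, -⟩
  · exact hl
  · obtain ⟨-, hpb, -⟩ := mem_conflicts.1 (hp ▸ mem_singleton_self p)
    obtain ⟨E, hEZ, -, hnear, -⟩ := h.blocked_structure hp (hpb ▸ hN)
    have hTE : ∀ q, T q ∈ points T Z \ E := fun q =>
      mem_sdiff.2 ⟨mem_points_left q, fun h' => h.notMem q (hEZ h')⟩
    have hs := hnear _ (hTE (i₀, false))
    rw [update_eq_self_of_apply hpb.symm] at hs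
    have d1 : hammingDist (T p) (T (i₀, false)) ≤ 1 := by
      rcases mem_insert.1 hs with h' | h'
      · simp [h']
      · exact hammingDist_le_of_mem_nbrs h'
    have d2 := hammingDist_le_two_of_update_mem (hnear _ (hTE (i₀, true)))
    have d3 := hammingDist_triangle (T (i₀, true)) (T p) (T (i₀, false))
    have d4 : hammingDist (T (i₀, true)) (T (i₀, false)) = m + 1 := by
      simp [hammingDist, hns]
    rw [hammingDist_comm _ (T p)] at d3
    have := h.three_le
    omega
  · exact (hns i₁ e ((hall (i₁, true) hi.symm).trans (hall (i₁, false) hi.symm).symm)).elim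

end IsSparse

/-- Apart from two pairs in dimension three, any `k` pairs of vertices of the `n`-cube can be linked
avoiding a set `Z` of vertices if `2 * k + #Z ≤ n + 1`. -/
theorem linkedAvoiding_of_card_le {n : ℕ} {ι : Type*} [Fintype ι] {T : ι × Bool → Fin n → Bool}
    {Z : Finset (Fin n → Bool)} (hT : Function.Injective T) (hTZ : ∀ p, T p ∉ Z)
    (hcard : 2 * Fintype.card ι + #Z ≤ n + 1) (hn : 2 ≤ Fintype.card ι → 4 ≤ n) :
    (cube n).LinkedAvoiding T Z := by
  classical
  induction hk : Fintype.card ι generalizing n ι with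
  | zero =>
    have := Fintype.card_eq_zero_iff.1 hk
    exact ⟨fun _ => ∅, fun i => isEmptyElim i, fun i => isEmptyElim i⟩
  | succ k ih =>
    by_cases hk1 : k = 0
    · subst hk1
      have := Fintype.card_le_one_iff_subsingleton.1 hk.le
      refine ⟨fun _ => {w | w ∉ Z}, fun i j hij => (hij (Subsingleton.elim i j)).elim,
        fun i => ⟨Set.disjoint_left.2 fun w hw => hw, ?_⟩⟩
      exact joinedIn_of_card_le Z (by omega) (hTZ _) (hTZ _)
    · have h4 := hn (by omega)
      obtain ⟨m, rfl⟩ : ∃ m, n = m + 1 := ⟨n - 1, by omega⟩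
      refine IsSparse.linkedAvoiding ⟨hT, hTZ, by omega, Or.inl hcard⟩ (by omega) ?_
      intro i W T' hT' hTW hW
      have hc : Fintype.card {j // j ≠ i} = k := by
        simp [hk]
      -- The exceptional dimension three is never reached: if two pairs remain, there were at least
      -- three, so `6 ≤ m + 2`.
      exact ih hT' hTW (by omega) (by omega) hc

theorem linkedAvoiding_opposite {d : ℕ} (hd1 : d ≠ 1) (hd3 : d ≠ 3) (v : Fin (d + 1) → Bool)
    {T : Fin ((d + 1) / 2) × Bool → Fin (d + 1) → Bool} (hT : Function.Injective T)
    (hTv : ∀ p, T p ≠ v ∧ T p ≠ opposite v) :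
    (cube (d + 1)).LinkedAvoiding T {v, opposite v} := by
  have hTZ : ∀ p, T p ∉ ({v, opposite v} : Finset (Fin (d + 1) → Bool)) := by simpa using hTv
  have hZ : #({v, opposite v} : Finset (Fin (d + 1) → Bool)) ≤ 2 := card_le_two
  suffices h : (cube (d + 1)).LinkedAvoiding T ({v, opposite v} : Finset (Fin (d + 1) → Bool)) by
    simpa using h
  -- For even `d` the count is exactly `d + 2`, as the general statement allows. For odd `d` it can
  -- be `d + 3`, and the excluded values `1` and `3` leave `d ≥ 5`, as the antipodal case of
  -- `IsSparse` requires.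
  by_cases hd : 2 * ((d + 1) / 2) = d
  · refine linkedAvoiding_of_card_le hT hTZ ?_ ?_
    · rw [Fintype.card_fin]; omega
    · rw [Fintype.card_fin]; omega
  · refine IsSparse.linkedAvoiding ⟨hT, hTZ, by omega, Or.inr ⟨?_, by omega, v, rfl⟩⟩ ?_ ?_
    · rw [Fintype.card_fin]; omega
    · rw [Fintype.card_fin]; omega
    · intro i W T' hT' hTW hW
      have hc : Fintype.card {j // j ≠ i} = (d + 1) / 2 - 1 := by simp
      rw [Fintype.card_fin] at hW
      exact linkedAvoiding_of_card_le hT' hTW (by omega) (by omega)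

/-! ### Faces, the link, and transfer to the graph of the complex. -/

theorem singleton_mem_faces {n : ℕ} (x : Fin n → Bool) : {x} ∈ faces n :=
  Or.inr ⟨Set.univ, x, by ext y; simp [funext_iff]⟩

theorem pair_mem_faces {n : ℕ} {x y : Fin n → Bool} (h : (cube n).Adj x y) : {x, y} ∈ faces n := by
  obtain ⟨e, rfl⟩ := h
  refine Or.inr ⟨{e}ᶜ, x, ?_⟩
  ext y
  simp only [Set.mem_insert_iff, Set.mem_singleton_iff, Set.mem_compl_iff, Set.mem_ofPred_eq]
  constructor
  · rintro (rfl | rfl) i hi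
    · rfl
    · exact flipAt_of_ne hi x
  · intro hy
    by_cases hye : y e = x e
    · left
      ext i
      by_cases hi : i = e
      exacts [hi ▸ hye, hy i hi]
    · right
      ext i
      by_cases hi : i = e
      · subst hi
        rw [flipAt_same]
        revert hye
        cases y i <;> cases x i <;> simp
      · rw [flipAt_of_ne hi, hy i hi]

theorem link_boundary {n : ℕ} (hn : 0 < n) (v : Fin n → Bool) :
    FaceComplex.link (boundary n) v = FaceComplex.deleteVerts (faces n) {v, opposite v} := by
  have hne : v ≠ opposite v := fun h => by
    have := congrFun h ⟨0, hn⟩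
    simp [opposite] at this
  ext F
  constructor
  · rintro ⟨⟨⟨hF, -⟩, G, ⟨hG, hGu⟩, hvG, hFG⟩, hvF⟩
    refine ⟨hF, fun x hx => ?_⟩
    rintro (rfl | rfl)
    · exact hvF hx
    · rcases hG with rfl | ⟨I, a, rfl⟩
      · exact hvG
      · refine hGu (Set.eq_univ_of_forall fun x i hi => ?_)
        have h1 := hvG i hi
        have h2 := hFG hx i hi
        rw [← h1] at h2
        simp [opposite] at h2
  · rintro ⟨hF, hFv⟩
    have hv : v ∉ F := fun h => hFv h (Or.inl rfl)
    have hv' : opposite v ∉ F := fun h => hFv h (Or.inr rfl)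
    refine ⟨⟨⟨hF, fun h => hv (h ▸ Set.mem_univ v)⟩, ?_⟩, hv⟩
    rcases hF with rfl | ⟨I, a, rfl⟩
    -- The empty face lies in the face `{v}`, which is proper because `0 < n`.
    · refine ⟨{v}, ⟨singleton_mem_faces v, fun h => ?_⟩, rfl, Set.empty_subset _⟩
      exact hne (Set.mem_singleton_iff.1 (h ▸ Set.mem_univ (opposite v))).symm
    -- A prescribed coordinate `j` violated by the opposite vertex is satisfied by `v`, so the facet
    -- given by `j` alone contains both `v` and the face.
    · simp only [Set.mem_ofPred_eq, not_forall] at hv'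
      obtain ⟨j, hj, hja⟩ := hv'
      have hvj : v j = a j := by
        revert hja
        simp only [opposite]
        cases v j <;> cases a j <;> simp
      refine ⟨{x | ∀ i ∈ ({j} : Set (Fin n)), x i = a i}, ⟨Or.inr ⟨{j}, a, rfl⟩, fun h => ?_⟩,
        ?_, ?_⟩
      · exact hja ((h ▸ Set.mem_univ (opposite v) :
          opposite v ∈ {x | ∀ i ∈ ({j} : Set (Fin n)), x i = a i}) j rfl)
      · rintro i rfl
        exact hvj
      · rintro x hx i rfl
        exact hx i hj

/-- A walk of the cube inside `U` is a walk of the graph of the complex `C`, if `C` contains all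
vertices in `U` and all edges between them. -/
theorem exists_walk_graph {n : ℕ} {C : Set (Set (Fin n → Bool))} {U : Set (Fin n → Bool)}
    (hC : ∀ x ∈ U, ∀ y ∈ U, (cube n).Adj x y → {x, y} ∈ C) {a b : Fin n → Bool}
    (p : (cube n).Walk a b) (hU : ∀ x ∈ U, {x} ∈ C) (hp : ∀ x ∈ p.support, x ∈ U)
    (ha : {a} ∈ C) (hb : {b} ∈ C) :
    ∃ q : (FaceComplex.graph C).Walk ⟨a, ha⟩ ⟨b, hb⟩, ∀ x ∈ q.support, x.1 ∈ U := by
  induction p with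
  | nil => exact ⟨.nil, by simpa using hp⟩
  | @cons a c b hac p ih =>
    simp only [SimpleGraph.Walk.support_cons, List.mem_cons, forall_eq_or_imp] at hp
    have hc := hp.2 c p.start_mem_support
    obtain ⟨q, hq⟩ := ih hp.2 (hU c hc) hb
    have hadj : (FaceComplex.graph C).Adj ⟨a, ha⟩ ⟨c, hU c hc⟩ :=
      ⟨fun h => hac.ne (congrArg Subtype.val h), hC a hp.1 c hc hac⟩
    exact ⟨.cons hadj q, by
      simp only [SimpleGraph.Walk.support_cons, List.mem_cons, forall_eq_or_imp]
      exact ⟨hp.1, hq⟩⟩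

theorem singleton_mem_deleteVerts {n : ℕ} {X : Set (Fin n → Bool)} {x : Fin n → Bool} :
    {x} ∈ FaceComplex.deleteVerts (faces n) X ↔ x ∉ X := by
  simp [FaceComplex.deleteVerts, singleton_mem_faces]

theorem le_card_vertices {d : ℕ} (v : Fin (d + 1) → Bool) :
    ((2 * ((d + 1) / 2) : ℕ) : ℕ∞) ≤
      ENat.card {x // {x} ∈ FaceComplex.deleteVerts (faces (d + 1)) {v, opposite v}} := by
  have h1 : ((({v, opposite v} : Finset (Fin (d + 1) → Bool))ᶜ : Finset _) : Set _) =
      {x | {x} ∈ FaceComplex.deleteVerts (faces (d + 1)) {v, opposite v}} := by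
    ext x
    simp [singleton_mem_deleteVerts, and_comm]
  change _ ≤ ENat.card
    ({x | {x} ∈ FaceComplex.deleteVerts (faces (d + 1)) {v, opposite v}} : Set _)
  rw [ENat.card_coe_set_eq, ← h1, Set.encard_coe_eq_coe_finsetCard, Nat.cast_le, card_compl,
    Fintype.card_fun, Fintype.card_bool, Fintype.card_fin, pow_succ]
  have h2 : #({v, opposite v} : Finset (Fin (d + 1) → Bool)) ≤ 2 := card_le_two
  have h3 := Nat.lt_two_pow_self (n := d)
  omega

end BoolCube

theorem mainTheorem6 (d : ℕ) (hd1 : d ≠ 1) (hd3 : d ≠ 3) (v : Fin (d + 1) → Bool) :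
    FaceComplex.link (BoolCube.boundary (d + 1)) v =
        FaceComplex.deleteVerts (BoolCube.faces (d + 1)) {v, BoolCube.opposite v} ∧
      (FaceComplex.graph (FaceComplex.link (BoolCube.boundary (d + 1)) v)).IsKLinked
        ((d + 1) / 2) := by
  have hlink := BoolCube.link_boundary (n := d + 1) (Nat.succ_pos d) v
  refine ⟨hlink, ?_⟩
  rw [hlink]
  refine ⟨BoolCube.le_card_vertices v, fun s t hst => ?_⟩
  obtain ⟨U, hU, hUv⟩ := BoolCube.linkedAvoiding_opposite hd1 hd3 v
    (T := fun p => (if p.2 then t p.1 else s p.1).1) (by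
      rintro ⟨i, c⟩ ⟨j, c'⟩ h
      have h' := Subtype.ext h
      rw [Sum.elim_injective] at hst
      obtain ⟨hs, ht, hne⟩ := hst
      cases c <;> cases c' <;> simp only [if_true, Bool.false_eq_true, if_false] at h'
      · rw [hs h']
      · exact (hne i j h').elim
      · exact (hne j i h'.symm).elim
      · rw [ht h'])
    (fun p => by
      have := BoolCube.singleton_mem_deleteVerts.1 (if p.2 then t p.1 else s p.1).2
      simpa only [Set.mem_insert_iff, Set.mem_singleton_iff, not_or] using this)
  have hUC : ∀ i, U i ⊆ {v, BoolCube.opposite v}ᶜ := fun i x hx =>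
    Set.disjoint_left.1 (hUv i).1 hx
  have hwalk : ∀ i, ∃ q : (FaceComplex.graph (FaceComplex.deleteVerts (BoolCube.faces (d + 1))
      {v, BoolCube.opposite v})).Walk (s i) (t i), ∀ x ∈ q.support, x.1 ∈ U i := by
    intro i
    obtain ⟨p, hp⟩ := (hUv i).2
    exact BoolCube.exists_walk_graph
      (C := FaceComplex.deleteVerts (BoolCube.faces (d + 1)) {v, BoolCube.opposite v})
      (fun x hx y hy hxy => ⟨BoolCube.pair_mem_faces hxy,
        Set.insert_subset (hUC i hx) (Set.singleton_subset_iff.2 (hUC i hy))⟩) p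
      (fun x hx => BoolCube.singleton_mem_deleteVerts.2 (hUC i hx)) hp (s i).2 (t i).2
  choose q hq using hwalk
  classical
  refine ⟨fun i => (q i).toPath, fun i j hij x hx hx' => ?_⟩
  exact Set.disjoint_left.1 (hU hij) (hq i x ((q i).support_toPath_subset_support hx))
    (hq j x ((q j).support_toPath_subset_support hx'))
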